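/- Let $0<\beta<1/2$, $0\le\theta\le 1$, and let $K$ be measurable on $(0,1)$ with $0<K_m\le K\le K_M<\infty$ almost everywhere. For $w\in L^2(0,1)$ let $$ {}^l I^\beta_x w=\frac1{\Gamma(\beta)}\int_0^x\frac{w(s)}{(x-s)^{1-\beta}}\,ds,\qquad {}^r I^\beta_x w=\frac1{\Gamma(\beta)}\int_x^1\frac{w(s)}{(s-x)^{1-\beta}}\,ds,\qquad I^\beta_\theta w(x)=\theta\,{}^l I^\beta_x w+(1-\theta)\,{}^r I^\beta_x w .$$ For $\mu>0$ let $H^\mu_0(0,1)$ be the completion of $C_0^\infty(0,1)$ in the norm $\|w\|_{H^\mu}=(\|w\|_{L^2(\mathbb R)}^2+\||\omega|^\mu\mathcal F w\|_{L^2(\mathbb R)}^2)^{1/2}$ (with $\mathcal F$ the unitary Fourier transform and functions extended by zero), and let $H^{-1}(0,1)$ be the dual space of $H^1_0(0,1)$ with the dual norm. Write $D$ for the weak derivative on $(0,1)$, and for $u\in H^{1-\beta}_0(0,1)$, $v\in H^1_0(0,1)$ put $$A(u,v)=\int_0^1 K\,(D I^\beta_\theta u)\,(Dv)\,dx .$$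 Let $w_l\in H^1(0,1)$ be the weak solution of $(K\,Dw_l,Dv)_{L^2(0,1)}=0$ for all $v\in H^1_0(0,1)$ with $w_l(0)=1$, $w_l(1)=0$, and let $u_l\in H^{1-\beta}_0(0,1)$ be the solution of $$I^\beta_\theta u_l(x)-(1-\theta)\,({}^r I^\beta_0 u_l)\,(1-x)-\theta\,({}^l I^\beta_1 u_l)\,x=w_l(x)-(1-x),\qquad 0\le x\le 1 .$$ Assume the nondegeneracy condition $$1+\theta\,({}^l I^\beta_1 u_l)-(1-\theta)\,({}^r I^\beta_0 u_l)\neq 0 .$$ Then $I^\beta_\theta u\in H^1(0,1)$ for all $u\in H^{1-\beta}_0(0,1)$, so that $A$ is well defined; $A$ is a bounded bilinear form on $H^{1-\beta}_0(0,1)\times H^1_0(0,1)$; and there is a constant $\kappa>0$, depending only on $\beta$, $\theta$ and $K$, such that $$\inf_{w\in H^{1-\beta}_0(0,1)\setminus\{0\}}\ \sup_{v\in H^1_0(0,1)\setminus\{0\}}\frac{A(w,v)}{\|w\|_{H^{1-\beta}}\|v\|_{H^1}}\ge\kappa,\qquad \sup_{w\in H^{1-\beta}_0(0,1)}A(w,v)>0\quad\text{for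 all } v\in H^1_0(0,1)\setminus\{0\},$$ and for every $f\in H^{-1}(0,1)$ there is a unique $u\in H^{1-\beta}_0(0,1)$ with $A(u,v)=\langle f,v\rangle$ for all $v\in H^1_0(0,1)$, and it satisfies $\|u\|_{H^{1-\beta}}\le\kappa^{-1}\|f\|_{H^{-1}}$. -/

import Mathlib

open Set Filter Topology MeasureTheory
open scoped ENNReal FourierTransform ContDiff

/-- Test functions: real `C^∞` functions with compact support contained in `(0,1)`,
regarded as functions on the line (extended by zero). -/
structure IsTest (φ : ℝ → ℝ) : Prop where
  smooth : ContDiff ℝ ∞ φ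
  compact : HasCompactSupport φ
  supp : tsupport φ ⊆ Ioo (0 : ℝ) 1

theorem IsTest.integrable {φ : ℝ → ℝ} (h : IsTest φ) :
    Integrable (fun x => (φ x : ℂ)) volume :=
  (h.smooth.continuous.integrable_of_hasCompactSupport h.compact).ofReal

theorem IsTest.zero : IsTest 0 :=
  ⟨contDiff_const, HasCompactSupport.zero, by simp [tsupport]⟩

theorem IsTest.add {φ ψ : ℝ → ℝ} (h : IsTest φ) (k : IsTest ψ) : IsTest (φ + ψ) :=
  ⟨h.smooth.add k.smooth, h.compact.add k.compact,
    (tsupport_add φ ψ).trans (union_subset h.supp k.supp)⟩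

theorem IsTest.smul {φ : ℝ → ℝ} (c : ℝ) (h : IsTest φ) : IsTest (c • φ) :=
  ⟨contDiff_const.smul h.smooth, h.compact.smul_left,
    (tsupport_smul_subset_right (fun _ => c) φ).trans h.supp⟩

/-- The function `ω ↦ |ω|^s (F φ)(ω)`, with the angular frequency written `ω = 2πξ`. With this
normalisation its `L²(dξ)` norm is the seminorm `‖|ω|^s F φ‖_{L²(dω)}` for the unitary Fourier
transform `F φ (ω) = (2π)^{-1/2} ∫ e^{-iωx} φ(x) dx`; for `s = 1` it equals `‖φ'‖_{L²}`. -/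
noncomputable def weightedFourier (s : ℝ) (φ : ℝ → ℝ) (ξ : ℝ) : ℂ :=
  ((|2 * Real.pi * ξ| ^ s : ℝ) : ℂ) * 𝓕 (fun x : ℝ => (φ x : ℂ)) ξ

/-- The Hilbert space `L²(ℝ; ℝ) × L²(ℝ; ℂ)` with norm `(‖w‖² + ‖g‖²)^{1/2}`. -/
abbrev L2Pair : Type := WithLp 2 (Lp ℝ 2 (volume : Measure ℝ) × Lp ℂ 2 (volume : Measure ℝ))

/-- The space `C_0^∞(0,1)` with the norm `‖φ‖_{H^s(ℝ)} = (‖φ‖² + ‖|ω|^s F φ‖²)^{1/2}`, realised by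
the isometric embedding `φ ↦ (φ, |ω|^s F φ)` in `L2Pair`. -/
noncomputable def testSpace (s : ℝ) : Submodule ℝ L2Pair where
  carrier := {p | ∃ φ : ℝ → ℝ, IsTest φ ∧ p.fst =ᵐ[volume] φ ∧
    p.snd =ᵐ[volume] weightedFourier s φ}
  zero_mem' := by
    refine ⟨0, IsTest.zero, Lp.coeFn_zero ℝ 2 volume, ?_⟩
    refine (Lp.coeFn_zero ℂ 2 volume).trans (Eventually.of_forall fun ξ => ?_)
    simp [weightedFourier, Real.fourier_eq]
  add_mem' := by
    rintro p q ⟨φ, hφ, h1, h2⟩ ⟨ψ, hψ, k1, k2⟩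
    refine ⟨φ + ψ, hφ.add hψ, (Lp.coeFn_add p.fst q.fst).trans (h1.add k1), ?_⟩
    refine ((Lp.coeFn_add p.snd q.snd).trans (h2.add k2)).trans
      (Eventually.of_forall fun ξ => ?_)
    have e : (fun x : ℝ => (((φ + ψ) x : ℝ) : ℂ)) = (fun x => (φ x : ℂ)) + fun x => (ψ x : ℂ) := by
      ext x; simp
    simp only [Pi.add_apply, weightedFourier]
    rw [← mul_add]
    congr 1
    have := VectorFourier.fourierIntegral_add Real.continuous_fourierChar
      (L := innerₗ ℝ) continuous_inner hφ.integrable hψ.integrable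
    have := congrFun this ξ
    simp only [Pi.add_apply] at this
    simp only [Complex.ofReal_add]
    exact this.symm
  smul_mem' := by
    rintro c p ⟨φ, hφ, h1, h2⟩
    refine ⟨c • φ, hφ.smul c, (Lp.coeFn_smul c p.fst).trans (h1.const_smul c), ?_⟩
    refine ((Lp.coeFn_smul c p.snd).trans (h2.const_smul c)).trans
      (Eventually.of_forall fun ξ => ?_)
    simp only [Pi.smul_apply, weightedFourier, Real.fourier_eq, smul_eq_mul,
      Complex.ofReal_mul, Complex.real_smul]
    rw [mul_left_comm]
    congr 1
    rw [← integral_const_mul]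
    congr 1
    ext x
    simp only [Circle.smul_def, smul_eq_mul]
    ring

/-- `H^s_0(0,1)`: the completion of `C_0^∞(0,1)` in the norm of `H^s(ℝ)`, realised as a closure.
An element `u` is a pair: `u.1.fst` is the underlying function, an element of `L²(ℝ)` vanishing
outside `(0,1)`, and `u.1.snd` is `|ω|^s F(u.1.fst)`, which `u.1.fst` determines. -/
abbrev H0 (s : ℝ) : Type := (testSpace s).topologicalClosure

/-- The function underlying an element of `H^s_0(0,1)`. -/
noncomputable def H0.fn {s : ℝ} (u : H0 s) : ℝ → ℝ := u.1.fst

/-- `g` is the weak derivative of `w` on `(0,1)`. -/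
def HasWeakDeriv (w g : ℝ → ℝ) : Prop :=
  LocallyIntegrableOn w (Ioo (0 : ℝ) 1) ∧ LocallyIntegrableOn g (Ioo (0 : ℝ) 1) ∧
    ∀ φ : ℝ → ℝ, IsTest φ →
      ∫ x in Ioo (0 : ℝ) 1, w x * deriv φ x = -∫ x in Ioo (0 : ℝ) 1, g x * φ x

open Classical in
/-- The weak derivative `D w` on `(0,1)`, unique up to null sets (zero if there is none). -/
noncomputable def weakDeriv (w : ℝ → ℝ) : ℝ → ℝ :=
  if h : ∃ g, HasWeakDeriv w g then h.choose else 0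

/-- `w` belongs to the Sobolev space `H^1(0,1)`. -/
def MemH1 (w : ℝ → ℝ) : Prop :=
  MemLp w 2 (volume.restrict (Ioo (0 : ℝ) 1)) ∧
    ∃ g, HasWeakDeriv w g ∧ MemLp g 2 (volume.restrict (Ioo (0 : ℝ) 1))

/-- The left fractional integral of order `σ` from `0`, evaluated at `x`. -/
noncomputable def leftInt (σ : ℝ) (w : ℝ → ℝ) (x : ℝ) : ℝ :=
  1 / Real.Gamma σ * ∫ s in Ioo 0 x, w s / (x - s) ^ (1 - σ)

/-- The right fractional integral of order `σ` up to `1`, evaluated at `x`. -/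
noncomputable def rightInt (σ : ℝ) (w : ℝ → ℝ) (x : ℝ) : ℝ :=
  1 / Real.Gamma σ * ∫ s in Ioo x 1, w s / (s - x) ^ (1 - σ)

/-- The two-sided fractional integral `I^β_θ`. -/
noncomputable def twoSidedInt (β θ : ℝ) (w : ℝ → ℝ) (x : ℝ) : ℝ :=
  θ * leftInt β w x + (1 - θ) * rightInt β w x

/-- The Petrov–Galerkin form `A(u,v) = (K D I^β_θ u, D v)_{L²(0,1)}`. -/
noncomputable def pgForm (K : ℝ → ℝ) (β θ : ℝ) (u : H0 (1 - β)) (v : H0 1) : ℝ :=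
  ∫ x in Ioo (0 : ℝ) 1, K x * weakDeriv (twoSidedInt β θ u.fn) x * weakDeriv v.fn x

/-- `w` (in its continuous representative) is the weak solution `w ∈ H^1(0,1)` of `(K w')' = 0`
in `(0,1)` with `w(0) = 1` and `w(1) = 0`. -/
structure IsLeftHarmonic (K w : ℝ → ℝ) : Prop where
  memH1 : MemH1 w
  cont : ContinuousOn w (Icc 0 1)
  at_zero : w 0 = 1
  at_one : w 1 = 0
  weak : ∀ v : H0 1, ∫ x in Ioo (0 : ℝ) 1, K x * weakDeriv w x * weakDeriv v.fn x = 0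

/-- `u` solves
`I^β_θ u - (1-θ) (I_r u)(0) (1-x) - θ (I_l u)(1) x = w(x) - (1-x)` on `[0,1]`. -/
def IsCorrector (β θ : ℝ) (w : ℝ → ℝ) (u : H0 (1 - β)) : Prop :=
  ∀ x ∈ Icc (0 : ℝ) 1,
    twoSidedInt β θ u.fn x - (1 - θ) * rightInt β u.fn 0 * (1 - x) - θ * leftInt β u.fn 1 * x
      = w x - (1 - x)

/-- The nondegeneracy condition `1 + θ (I_l u_l)(1) - (1-θ) (I_r u_l)(0) ≠ 0`, where `w_l` is the
left `K`-harmonic function and `u_l` the function of `H^{1-β}_0(0,1)` determined by `w_l`. -/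
def Nondegenerate (K : ℝ → ℝ) (β θ : ℝ) : Prop :=
  ∀ (wl : ℝ → ℝ) (ul : H0 (1 - β)), IsLeftHarmonic K wl → IsCorrector β θ wl ul →
    1 + θ * leftInt β ul.fn 1 - (1 - θ) * rightInt β ul.fn 0 ≠ 0
open scoped Real InnerProductSpace SchwartzMap

/-!
On the Fourier side `D I^β` acts on `H^{1-β}_0(0,1)` as multiplication of `|ω|^{1-β} F u` by a
unimodular phase. Hence `⟨D I_l u, D I_r u⟩ = cos (πβ) |u|²_{1-β}` over the whole line, which for
`β < 1/2` bounds `D I^β_θ` from below, uniformly in `θ`. The range of `D I^β_1` is orthogonal to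
`(1-x)^{-β}`, so by the method of continuity in `θ` no `D I^β_θ` is onto `L²(0,1)`. On the other
hand `⟨D I^β φ, D φ⟩ = cos (πβ/2) |φ|²_{1-β/2}` on both sides, so that no nonzero `D v` with
`v ∈ H^1_0(0,1)` is orthogonal to the range; since these `D v` fill the orthogonal complement of
the constants, the range of `D I^β_θ` has codimension exactly one.

The form `(K D I^β_θ u, D v)` is therefore an isomorphism onto the dual of `H^1_0(0,1)` as soon as
the range of `D I^β_θ` misses the function `1/K` of unit flux. If it contained `1/K`, then, `w_l'`
being a multiple of `1/K`, the same multiple of its preimage would be a function `u_l` violating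
the nondegeneracy condition.
-/

section LaplaceTransform

/-- The measure `y ^ (a - 1) dy` on the half line `(0, ∞)`. -/
noncomputable def rpowMeasure (a : ℝ) : Measure ℝ :=
  (volume.restrict (Ioi (0 : ℝ))).withDensity fun y => ((y ^ (a - 1)).toNNReal : ℝ≥0∞)

variable {a : ℝ}

theorem coe_toNNReal_rpow_smul {E : Type*} [AddCommGroup E] [Module ℝ E] (a : ℝ) {y : ℝ}
    (hy : y ∈ Ioi (0 : ℝ)) (v : E) : (y ^ (a - 1)).toNNReal • v = y ^ (a - 1) • v := by
  rw [NNReal.smul_def, Real.coe_toNNReal _ (Real.rpow_nonneg (le_of_lt hy) _)]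

theorem integral_rpowMeasure {E : Type*} [NormedAddCommGroup E] [NormedSpace ℝ E] (f : ℝ → E) :
    ∫ y, f y ∂rpowMeasure a = ∫ y in Ioi (0 : ℝ), y ^ (a - 1) • f y := by
  rw [rpowMeasure, integral_withDensity_eq_integral_smul (by fun_prop)]
  exact setIntegral_congr_fun measurableSet_Ioi fun y hy => coe_toNNReal_rpow_smul a hy _

theorem integrableOn_rpow_mul_exp_neg_mul (ha : 0 < a) {b : ℝ} (hb : 0 < b) :
    IntegrableOn (fun y : ℝ => y ^ (a - 1) * Real.exp (-(b * y))) (Ioi 0) := by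
  simpa using integrableOn_rpow_mul_exp_neg_mul_rpow (p := 1) (s := a - 1) (by linarith)
    one_pos hb

theorem Iio_subset_integrableExpSet_rpowMeasure (ha : 0 < a) :
    Iio 0 ⊆ ProbabilityTheory.integrableExpSet id (rpowMeasure a) := by
  intro t ht
  rw [ProbabilityTheory.integrableExpSet, mem_ofPred_eq, rpowMeasure,
    integrable_withDensity_iff_integrable_smul (by fun_prop)]
  refine (integrableOn_rpow_mul_exp_neg_mul ha (neg_pos.2 ht)).congr_fun (fun y hy => ?_)
    measurableSet_Ioi
  rw [coe_toNNReal_rpow_smul a hy]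
  simp

theorem mgf_rpowMeasure (ha : 0 < a) {t : ℝ} (ht : t < 0) :
    ProbabilityTheory.mgf id (rpowMeasure a) t = (-t) ^ (-a) * Real.Gamma a := by
  have h := Real.integral_rpow_mul_exp_neg_mul_Ioi ha (neg_pos.2 ht)
  rw [one_div, Real.inv_rpow (neg_pos.2 ht).le, ← Real.rpow_neg (neg_pos.2 ht).le] at h
  simpa [ProbabilityTheory.mgf, integral_rpowMeasure] using h

theorem complexMGF_rpowMeasure (ha : 0 < a) {z : ℂ} (hz : z.re < 0) :
    ProbabilityTheory.complexMGF id (rpowMeasure a) z = (-z) ^ (-a : ℂ) * Real.Gamma a := by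
  have h_left : AnalyticOnNhd ℂ (ProbabilityTheory.complexMGF id (rpowMeasure a))
      {z | z.re < 0} := by
    refine ProbabilityTheory.analyticOnNhd_complexMGF.mono fun z hz => ?_
    exact interior_maximal (Iio_subset_integrableExpSet_rpowMeasure ha) isOpen_Iio hz
  have h_right : AnalyticOnNhd ℂ (fun z : ℂ => (-z) ^ (-a : ℂ) * Real.Gamma a) {z | z.re < 0} := by
    intro z hz
    refine (analyticAt_id.neg.cpow analyticAt_const (Or.inl ?_)).mul analyticAt_const
    simpa using hz
  have h_real : ∀ t : ℝ, t < 0 → ProbabilityTheory.complexMGF id (rpowMeasure a) t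
      = (-t : ℂ) ^ (-a : ℂ) * Real.Gamma a := by
    intro t ht
    rw [ProbabilityTheory.complexMGF_ofReal, mgf_rpowMeasure ha ht, Complex.ofReal_mul,
      Complex.ofReal_cpow (neg_pos.2 ht).le, Complex.ofReal_neg, Complex.ofReal_neg]
  have h_tendsto : Tendsto (fun t : ℝ => (t : ℂ)) (𝓝[≠] (-1 : ℝ)) (𝓝[≠] (-1 : ℂ)) :=
    (Complex.continuous_ofReal.tendsto' _ _ (by simp)).inf <| tendsto_principal_principal.2
      fun t ht => by simpa [← Complex.ofReal_one, ← Complex.ofReal_neg] using ht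
  refine h_left.eqOn_of_preconnected_of_frequently_eq h_right
    (convex_halfSpace_re_lt 0).isPreconnected (z₀ := -1) (by simp)
    (h_tendsto.frequently (Eventually.frequently ?_)) hz
  filter_upwards [nhdsWithin_le_nhds (Iio_mem_nhds neg_one_lt_zero)] with t ht using h_real t ht

/-- The kernel `y_+ ^ (a - 1) e ^ (-εy)` of a regularised fractional integral. -/
noncomputable def expRpowKernel (a ε : ℝ) : ℝ → ℂ :=
  (Ioi (0 : ℝ)).indicator fun y => ((y ^ (a - 1) * Real.exp (-(ε * y)) : ℝ) : ℂ)

theorem integrable_expRpowKernel (ha : 0 < a) {ε : ℝ} (hε : 0 < ε) :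
    Integrable (expRpowKernel a ε) :=
  (integrable_indicator_iff measurableSet_Ioi).2
    (integrableOn_rpow_mul_exp_neg_mul ha hε).ofReal

theorem fourier_expRpowKernel (ha : 0 < a) {ε : ℝ} (hε : 0 < ε) (ξ : ℝ) :
    𝓕 (expRpowKernel a ε) ξ
      = (ε + (2 * π * ξ : ℝ) * Complex.I) ^ (-a : ℂ) * Real.Gamma a := by
  have h_mgf := complexMGF_rpowMeasure ha (z := -(ε + (2 * π * ξ : ℝ) * Complex.I))
    (by simpa using hε)
  rw [neg_neg, ProbabilityTheory.complexMGF, integral_rpowMeasure] at h_mgf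
  rw [← h_mgf, Real.fourier_eq', ← integral_indicator measurableSet_Ioi]
  refine integral_congr_ae (Eventually.of_forall fun y => ?_)
  by_cases hy : y ∈ Ioi (0 : ℝ)
  · simp only [expRpowKernel, indicator_of_mem hy, Complex.ofReal_mul, Complex.ofReal_exp, id,
      smul_eq_mul, Complex.real_smul]
    rw [mul_left_comm, ← Complex.exp_add]
    congr 2
    simp only [RCLike.inner_apply, conj_trivial]
    push_cast
    ring
  · simp [expRpowKernel, indicator_of_notMem hy]

end LaplaceTransform

theorem integral_mul_fourierInv_sub {k g : ℝ → ℂ} (hk : Integrable k) (hg : Integrable g)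
    (σ x : ℝ) :
    ∫ y, k y * 𝓕⁻ g (x - σ * y) = 𝓕⁻ (fun ξ => 𝓕 k (σ * ξ) * g ξ) x := by
  have h_int : Integrable (fun p : ℝ × ℝ =>
      (𝐞 (p.2 * (x - σ * p.1)) : ℂ) * (k p.1 * g p.2)) (volume.prod volume) := by
    refine (hk.mul_prod hg).bdd_mul (c := 1) ?_
      (Eventually.of_forall fun p => (Circle.norm_coe _).le)
    exact Continuous.aestronglyMeasurable (by fun_prop)
  calc ∫ y, k y * 𝓕⁻ g (x - σ * y)
      = ∫ y, ∫ ξ, (𝐞 (ξ * (x - σ * y)) : ℂ) * (k y * g ξ) := by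
        congr with y
        rw [Real.fourierInv_eq, ← integral_const_mul]
        congr with ξ
        simp only [RCLike.inner_apply, conj_trivial, Circle.smul_def, smul_eq_mul,
          mul_comm (x - σ * y)]
        ring
    _ = ∫ ξ, ∫ y, (𝐞 (ξ * (x - σ * y)) : ℂ) * (k y * g ξ) := integral_integral_swap h_int
    _ = 𝓕⁻ (fun ξ => 𝓕 k (σ * ξ) * g ξ) x := by
        rw [Real.fourierInv_eq]
        congr with ξ
        rw [Real.fourier_eq, Circle.smul_def, smul_eq_mul, ← integral_mul_const,
          ← integral_const_mul]
        congr with y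
        have h_split : ξ * (x - σ * y) = x * ξ + -(σ * ξ * y) := by ring
        simp only [RCLike.inner_apply, conj_trivial, Circle.smul_def, smul_eq_mul, h_split,
          AddChar.map_add_eq_mul, Circle.coe_mul]
        ring

section FractionalKernel

theorem integrable_indicator_const_mul_rpow {β : ℝ} (hβ : 0 < β) (M R : ℝ) :
    Integrable ((Ioc (0 : ℝ) R).indicator fun y => M * y ^ (β - 1)) := by
  rw [integrable_indicator_iff measurableSet_Ioc]
  rcases le_or_gt 0 R with hR | hR
  · exact ((intervalIntegrable_iff_integrableOn_Ioc_of_le hR).1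
      (intervalIntegral.intervalIntegrable_rpow' (by linarith))).const_mul M
  · simp [Ioc_eq_empty (not_lt.2 hR.le)]

theorem exists_norm_rpow_smul_comp_le {E : Type*} [NormedAddCommGroup E] [NormedSpace ℝ E]
    {f : ℝ → E} (hf : Continuous f) (hc : HasCompactSupport f) {σ : ℝ} (hσ : |σ| = 1) (β N : ℝ) :
    ∃ M R : ℝ, ∀ x : ℝ, |x| ≤ N → ∀ y : ℝ, 0 < y →
      ‖y ^ (β - 1) • f (x - σ * y)‖ ≤ (Ioc (0 : ℝ) R).indicator (fun y => M * y ^ (β - 1)) y := by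
  obtain ⟨M, hM⟩ := hf.bounded_above_of_compact_support hc
  obtain ⟨R, hR⟩ := hc.isCompact.isBounded.subset_closedBall 0
  refine ⟨M, R + N, fun x hx y hy => ?_⟩
  rw [norm_smul, Real.norm_of_nonneg (Real.rpow_nonneg hy.le _)]
  by_cases h : y ≤ R + N
  · rw [indicator_of_mem (show y ∈ Ioc 0 (R + N) from ⟨hy, h⟩), mul_comm]
    gcongr
    exact hM _
  · have h_far : R < |x - σ * y| := by
      have h_abs : |σ * y| = y := by rw [abs_mul, hσ, one_mul, abs_of_pos hy]
      linarith [abs_sub_abs_le_abs_sub (σ * y) x, abs_sub_comm (σ * y) x]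
    have h_zero : f (x - σ * y) = 0 := image_eq_zero_of_notMem_tsupport fun h_mem =>
      h_far.not_ge (mem_closedBall_zero_iff.1 (hR h_mem))
    rw [indicator_of_notMem fun h' => h h'.2, h_zero, norm_zero, mul_zero]

theorem integrableOn_rpow_smul_comp {E : Type*} [NormedAddCommGroup E] [NormedSpace ℝ E]
    {f : ℝ → E} (hf : Continuous f) (hc : HasCompactSupport f) {σ β : ℝ} (hσ : |σ| = 1)
    (hβ : 0 < β) (x : ℝ) :
    IntegrableOn (fun y : ℝ => y ^ (β - 1) • f (x - σ * y)) (Ioi 0) := by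
  obtain ⟨M, R, h⟩ := exists_norm_rpow_smul_comp_le hf hc hσ β |x|
  refine (integrable_indicator_const_mul_rpow hβ M R).integrableOn.mono' ?_ ?_
  · exact ((by fun_prop : Measurable fun y : ℝ => y ^ (β - 1)).aestronglyMeasurable).smul
      (by fun_prop : Continuous fun y : ℝ => f (x - σ * y)).aestronglyMeasurable
  · filter_upwards [ae_restrict_mem measurableSet_Ioi] with y hy using h x le_rfl y hy

theorem tendsto_integral_expRpowKernel_mul {f : ℝ → ℂ} (hf : Continuous f)
    (hc : HasCompactSupport f) {σ β : ℝ} (hσ : |σ| = 1) (hβ : 0 < β) (x : ℝ) :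
    Tendsto (fun ε : ℝ => ∫ y, expRpowKernel β ε y * f (x - σ * y)) (𝓝[>] 0)
      (𝓝 (∫ y in Ioi (0 : ℝ), y ^ (β - 1) • f (x - σ * y))) := by
  have h_eq : ∀ ε : ℝ, ∫ y, expRpowKernel β ε y * f (x - σ * y)
      = ∫ y in Ioi (0 : ℝ), (y ^ (β - 1) * Real.exp (-(ε * y))) • f (x - σ * y) := by
    intro ε
    rw [← integral_indicator measurableSet_Ioi]
    congr with y
    by_cases hy : y ∈ Ioi (0 : ℝ) <;> simp [expRpowKernel, hy]
  simp only [h_eq]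
  refine tendsto_integral_filter_of_dominated_convergence _ ?_ ?_
    (integrableOn_rpow_smul_comp hf hc hσ hβ x).norm ?_
  · refine Eventually.of_forall fun ε => AEStronglyMeasurable.smul
      (f := fun y : ℝ => y ^ (β - 1) * Real.exp (-(ε * y))) ?_ ?_
    · exact Measurable.aestronglyMeasurable (by fun_prop)
    · exact Continuous.aestronglyMeasurable (by fun_prop)
  · filter_upwards [self_mem_nhdsWithin] with ε hε
    filter_upwards [ae_restrict_mem measurableSet_Ioi] with y hy
    have h_exp : Real.exp (-(ε * y)) ≤ 1 :=
      Real.exp_le_one_iff.2 (neg_nonpos.2 (mul_pos hε hy).le)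
    rw [norm_smul, norm_smul, norm_mul, Real.norm_of_nonneg (Real.exp_pos _).le]
    gcongr
    exact mul_le_of_le_one_right (norm_nonneg _) h_exp
  · refine Eventually.of_forall fun y => ?_
    have h_cont : Continuous fun ε : ℝ =>
        (y ^ (β - 1) * Real.exp (-(ε * y))) • f (x - σ * y) := by fun_prop
    exact (h_cont.tendsto' 0 _ (by simp)).mono_left nhdsWithin_le_nhds

theorem tendsto_fourierInv_cpow_mul {g : ℝ → ℂ} (hg : AEStronglyMeasurable g) {σ β : ℝ}
    (hσ : |σ| = 1) (hβ : 0 < β) (h_int : Integrable fun ξ : ℝ => |2 * π * ξ| ^ (-β) * ‖g ξ‖)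
    (x : ℝ) :
    Tendsto (fun ε : ℝ =>
        𝓕⁻ (fun ξ => (ε + (2 * π * (σ * ξ) : ℝ) * Complex.I) ^ (-β : ℂ) * g ξ) x) (𝓝[>] 0)
      (𝓝 (𝓕⁻ (fun ξ => ((2 * π * (σ * ξ) : ℝ) * Complex.I) ^ (-β : ℂ) * g ξ) x)) := by
  simp only [Real.fourierInv_eq]
  have h_ne : ∀ᵐ ξ : ℝ, ξ ≠ 0 := Measure.ae_ne volume 0
  refine tendsto_integral_filter_of_dominated_convergence _ ?_ ?_ h_int ?_
  · exact Eventually.of_forall fun ε => .smul (Continuous.aestronglyMeasurable (by fun_prop))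
      (.mul (Measurable.aestronglyMeasurable (by fun_prop)) hg)
  · refine Eventually.of_forall fun ε => ?_
    filter_upwards [h_ne] with ξ hξ
    have h_abs : |2 * π * (σ * ξ)| = |2 * π * ξ| := by simp [abs_mul, hσ]
    rw [Circle.norm_smul, norm_mul, ← Complex.ofReal_neg, Complex.norm_cpow_real]
    gcongr ?_ * _
    refine Real.rpow_le_rpow_of_nonpos (by positivity) ?_ (neg_nonpos.2 hβ.le)
    simpa [← h_abs] using
      Complex.abs_im_le_norm ((ε : ℂ) + (2 * π * (σ * ξ) : ℝ) * Complex.I)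
  · filter_upwards [h_ne] with ξ hξ
    have h_slit : (2 * π * (σ * ξ) : ℝ) * Complex.I ∈ Complex.slitPlane := by
      have hσ₀ : σ ≠ 0 := by rintro rfl; simp at hσ
      refine Or.inr ?_
      simp [hξ, hσ₀, Real.pi_ne_zero]
    have h_base : Tendsto (fun ε : ℝ => (ε : ℂ) + (2 * π * (σ * ξ) : ℝ) * Complex.I) (𝓝[>] 0)
        (𝓝 ((2 * π * (σ * ξ) : ℝ) * Complex.I)) :=
      (Continuous.tendsto' (by fun_prop) 0 _ (by simp)).mono_left nhdsWithin_le_nhds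
    exact (((continuousAt_id.cpow continuousAt_const h_slit).tendsto.comp h_base).mul_const
      _).const_smul _

theorem integral_rpow_smul_comp_eq_fourierInv {σ β : ℝ} (hσ : |σ| = 1) (hβ : 0 < β)
    (f : 𝓢(ℝ, ℂ)) (hc : HasCompactSupport f)
    (h_int : Integrable fun ξ : ℝ => |2 * π * ξ| ^ (-β) * ‖𝓕 f ξ‖) (x : ℝ) :
    ∫ y in Ioi (0 : ℝ), y ^ (β - 1) • f (x - σ * y)
      = Real.Gamma β *
        𝓕⁻ (fun ξ => ((2 * π * (σ * ξ) : ℝ) * Complex.I) ^ (-β : ℂ) * 𝓕 f ξ) x := by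
  have h_inv : ∀ t : ℝ, f t = 𝓕⁻ (⇑(𝓕 f : 𝓢(ℝ, ℂ))) t := fun t => by
    rw [← SchwartzMap.fourierInv_coe, FourierTransform.fourierInv_fourier_eq]
  refine tendsto_nhds_unique (tendsto_integral_expRpowKernel_mul f.continuous hc hσ hβ x)
    (((tendsto_fourierInv_cpow_mul (𝓕 f).continuous.aestronglyMeasurable hσ hβ h_int
      x).const_mul _).congr' ?_)
  filter_upwards [self_mem_nhdsWithin] with ε hε
  simp only [h_inv]
  rw [integral_mul_fourierInv_sub (integrable_expRpowKernel hβ hε) (𝓕 f).integrable]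
  simp only [fourier_expRpowKernel hβ hε, Real.fourierInv_eq, ← integral_const_mul]
  congr with ξ
  rw [mul_smul_comm]
  ring_nf

end FractionalKernel

section BoundedMultiplication

variable {α 𝕜 : Type*} [RCLike 𝕜] [MeasurableSpace α] {μ : Measure α} {m : α → 𝕜}

/-- Multiplication by an essentially bounded function, as an operator on `L²`. -/
noncomputable def mulLp (hm : MemLp m ∞ μ) : Lp 𝕜 2 μ →L[𝕜] Lp 𝕜 2 μ :=
  (ContinuousLinearMap.mul 𝕜 𝕜).holderL μ ∞ 2 2 (hm.toLp m)

theorem coeFn_mulLp (hm : MemLp m ∞ μ) (f : Lp 𝕜 2 μ) :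
    mulLp hm f =ᵐ[μ] fun x => m x * f x := by
  filter_upwards [ContinuousLinearMap.coeFn_holder (r := 2) (ContinuousLinearMap.mul 𝕜 𝕜)
    (hm.toLp m) f, hm.coeFn_toLp] with x hx hmx
  exact hx.trans (by rw [hmx, ContinuousLinearMap.mul_apply'])

end BoundedMultiplication

theorem coeFn_fourierInv_of_integrable (g : Lp ℂ 2 (volume : Measure ℝ)) (hg : Integrable g) :
    (𝓕⁻ g : Lp ℂ 2 (volume : Measure ℝ)) =ᵐ[volume] 𝓕⁻ (g : ℝ → ℂ) := by
  have hpairing : Continuous fun p : ℝ × ℝ => (-innerₗ ℝ) p.1 p.2 := by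
    simp only [LinearMap.neg_apply, innerₗ_apply_apply]; fun_prop
  have hcont : Continuous (𝓕⁻ (g : ℝ → ℂ)) :=
    VectorFourier.fourierIntegral_continuous Real.continuous_fourierChar hpairing hg
  -- Both sides define the same distribution: test against `ψ` and move `𝓕⁻` onto `ψ`.
  refine ae_eq_of_integral_contDiff_smul_eq
    ((Lp.memLp _).locallyIntegrable (by norm_num)) hcont.locallyIntegrable fun ψ hψ hc => ?_
  set Ψ : 𝓢(ℝ, ℂ) := (hc.comp_left Complex.ofReal_zero : HasCompactSupport fun x => (ψ x : ℂ))
    |>.toSchwartzMap (Complex.ofRealCLM.contDiff.comp hψ)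
  have hdistrib : ∫ x, Ψ x • (𝓕⁻ g : Lp ℂ 2 (volume : Measure ℝ)) x = ∫ x, (𝓕⁻ Ψ) x • g x := by
    rw [← Lp.toTemperedDistribution_apply, ← Lp.toTemperedDistribution_apply,
      ← Lp.fourierInv_toTemperedDistribution_eq]
    rfl
  have hflip : ∫ x, (𝓕⁻ Ψ) x • g x = ∫ x, Ψ x • 𝓕⁻ (g : ℝ → ℂ) x := by
    rw [SchwartzMap.fourierInv_coe]
    refine (VectorFourier.integral_fourierIntegral_smul_eq_flip (μ := volume) (ν := volume)
      Real.continuous_fourierChar hpairing Ψ.integrable hg).trans ?_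
    rw [show (-innerₗ ℝ : ℝ →ₗ[ℝ] ℝ →ₗ[ℝ] ℝ).flip = -innerₗ ℝ by
      ext; simp only [LinearMap.flip_apply, LinearMap.neg_apply, innerₗ_apply_apply]]
    rfl
  exact hdistrib.trans hflip

namespace IsTest

variable {φ : ℝ → ℝ}

theorem hasCompactSupport_ofReal (h : IsTest φ) : HasCompactSupport fun x => (φ x : ℂ) :=
  h.compact.comp_left Complex.ofReal_zero

theorem deriv (h : IsTest φ) : IsTest (deriv φ) :=
  ⟨h.smooth.iterate_deriv 1, h.compact.deriv, (tsupport_deriv_subset (𝕜 := ℝ)).trans h.supp⟩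

theorem eq_zero (h : IsTest φ) {x : ℝ} (hx : x ∉ Ioo (0 : ℝ) 1) : φ x = 0 :=
  image_eq_zero_of_notMem_tsupport fun hmem => hx (h.supp hmem)

theorem continuous (h : IsTest φ) : Continuous φ := h.smooth.continuous

theorem hasDerivAt (h : IsTest φ) (x : ℝ) : HasDerivAt φ (_root_.deriv φ x) x :=
  (h.smooth.differentiable (by simp) x).hasDerivAt

/-- A test function as a complex valued Schwartz function. -/
noncomputable def schwartz (h : IsTest φ) : 𝓢(ℝ, ℂ) :=
  h.hasCompactSupport_ofReal.toSchwartzMap (Complex.ofRealCLM.contDiff.comp h.smooth)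

@[simp]
theorem schwartz_apply (h : IsTest φ) (x : ℝ) : h.schwartz x = φ x := rfl

theorem fourier_schwartz (h : IsTest φ) :
    ⇑(𝓕 h.schwartz : 𝓢(ℝ, ℂ)) = 𝓕 fun x : ℝ => (φ x : ℂ) := rfl

theorem fourier_schwartz_deriv (h : IsTest φ) (ξ : ℝ) :
    (𝓕 h.deriv.schwartz : 𝓢(ℝ, ℂ)) ξ
      = ((2 * π * ξ : ℝ) : ℂ) * Complex.I * 𝓕 (fun x : ℝ => (φ x : ℂ)) ξ := by
  have hd : _root_.deriv (fun x : ℝ => (φ x : ℂ)) = fun x => ((_root_.deriv φ x : ℝ) : ℂ) :=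
    funext fun x => (h.hasDerivAt x).ofReal_comp.deriv
  rw [fourier_schwartz, ← hd, Real.fourier_deriv h.integrable
    (fun x => (h.hasDerivAt x).ofReal_comp.differentiableAt) (by rw [hd]; exact h.deriv.integrable)]
  simp only [smul_eq_mul]
  push_cast
  ring

end IsTest

theorem memLp_abs_rpow_mul_schwartz {a : ℝ} (ha : 0 ≤ a) (g : 𝓢(ℝ, ℂ)) (p : ℝ≥0∞) :
    MemLp (fun ξ : ℝ => ((|2 * π * ξ| ^ a : ℝ) : ℂ) * g ξ) p volume := by
  obtain ⟨k, hk⟩ := exists_nat_ge a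
  set G : 𝓢(ℝ, ℂ) := SchwartzMap.smulLeftCLM ℂ (fun ξ : ℝ => (1 + ξ ^ 2) ^ k) g
  have hG (ξ : ℝ) : G ξ = (((1 + ξ ^ 2) ^ k : ℝ)) • g ξ :=
    SchwartzMap.smulLeftCLM_apply_apply (by fun_prop) g ξ
  have hpow (ξ : ℝ) : |ξ| ^ a ≤ (1 + ξ ^ 2) ^ k :=
    calc |ξ| ^ a ≤ (1 + ξ ^ 2) ^ a :=
          Real.rpow_le_rpow (abs_nonneg _)
            (by nlinarith [sq_nonneg (|ξ| - 1), sq_abs ξ, abs_nonneg ξ]) ha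
      _ ≤ (1 + ξ ^ 2) ^ (k : ℝ) :=
          Real.rpow_le_rpow_of_exponent_le (by nlinarith [sq_nonneg ξ]) hk
      _ = (1 + ξ ^ 2) ^ k := Real.rpow_natCast _ _
  refine (G.memLp p volume).of_le_mul (c := (2 * π) ^ a)
    ((Measurable.aestronglyMeasurable (by fun_prop)).mul g.continuous.aestronglyMeasurable)
    (Eventually.of_forall fun ξ => ?_)
  rw [hG, norm_mul, norm_smul, Complex.norm_real, ← mul_assoc,
    Real.norm_of_nonneg (by positivity), Real.norm_of_nonneg (by positivity), abs_mul,
    abs_of_pos Real.two_pi_pos, Real.mul_rpow Real.two_pi_pos.le (abs_nonneg _)]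
  gcongr
  exact hpow ξ

theorem memLp_weightedFourier {s : ℝ} (hs : 0 ≤ s) {φ : ℝ → ℝ} (h : IsTest φ) (p : ℝ≥0∞) :
    MemLp (weightedFourier s φ) p volume :=
  memLp_abs_rpow_mul_schwartz hs (𝓕 h.schwartz) p

/-- The phase of the Fourier symbol `(2πσξi)^(-β) (2πξi)` of `D I^β`, where `I^β` is the left
(`σ = 1`) or the right (`σ = -1`) fractional integral; the modulus is `|2πξ|^(1-β)`. -/
noncomputable def phase (β σ ξ : ℝ) : ℂ :=
  Complex.exp ((Real.sign ξ * ((1 - σ * β) * (π / 2)) : ℝ) * Complex.I)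

theorem norm_phase (β σ ξ : ℝ) : ‖phase β σ ξ‖ = 1 :=
  Complex.norm_exp_ofReal_mul_I _

theorem measurable_phase (β σ : ℝ) : Measurable (phase β σ) := by
  have : Measurable Real.sign :=
    .ite measurableSet_Iio measurable_const (.ite measurableSet_Ioi measurable_const
      measurable_const)
  unfold phase
  fun_prop

theorem memLp_top_phase (β σ : ℝ) : MemLp (phase β σ) ∞ (volume : Measure ℝ) :=
  memLp_top_of_bound (measurable_phase β σ).aestronglyMeasurable 1
    (Eventually.of_forall fun ξ => (norm_phase β σ ξ).le)

theorem re_conj_phase_mul_phase (β σ β' σ' : ℝ) {ξ : ℝ} (hξ : ξ ≠ 0) :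
    (starRingEnd ℂ (phase β σ ξ) * phase β' σ' ξ).re
      = Real.cos (π * (σ * β - σ' * β') / 2) := by
  rw [phase, phase, ← Complex.exp_conj, ← Complex.exp_add, map_mul, Complex.conj_ofReal,
    Complex.conj_I, mul_neg, ← neg_mul, ← add_mul, ← Complex.ofReal_neg, ← Complex.ofReal_add,
    Complex.exp_ofReal_mul_I_re]
  obtain h | h := Real.sign_apply_eq_of_ne_zero ξ hξ <;> rw [h]
  · rw [← Real.cos_neg]; congr 1; ring
  · congr 1; ring

theorem ofReal_mul_I_cpow {x : ℝ} (hx : x ≠ 0) (a : ℝ) :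
    ((x : ℂ) * Complex.I) ^ (a : ℂ)
      = ((|x| ^ a : ℝ) : ℂ) * Complex.exp ((Real.sign x * (a * (π / 2)) : ℝ) * Complex.I) := by
  have habs : 0 < |x| := abs_pos.2 hx
  have hlog : Complex.log ((x : ℂ) * Complex.I)
      = (Real.log |x| : ℝ) + (Real.sign x * (π / 2) : ℝ) * Complex.I := by
    rcases hx.lt_or_gt with h | h
    · rw [show (x : ℂ) * Complex.I = (|x| : ℝ) * -Complex.I by rw [abs_of_neg h]; push_cast; ring,
        Complex.log_ofReal_mul habs (neg_ne_zero.2 Complex.I_ne_zero), Complex.log_neg_I,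
        Real.sign_of_neg h]
      push_cast; ring
    · rw [Complex.log_ofReal_mul h Complex.I_ne_zero, Complex.log_I, Real.sign_of_pos h,
        abs_of_pos h]
      push_cast; ring
  rw [Complex.cpow_def_of_ne_zero (mul_ne_zero (Complex.ofReal_ne_zero.2 hx) Complex.I_ne_zero),
    hlog, Real.rpow_def_of_pos habs, Complex.ofReal_exp, ← Complex.exp_add]
  congr 1
  push_cast; ring

theorem cpow_mul_eq_phase_mul {σ : ℝ} (hσ : |σ| = 1) (β : ℝ) {ξ : ℝ} (hξ : ξ ≠ 0) :
    ((2 * π * (σ * ξ) : ℝ) * Complex.I) ^ (-β : ℂ) * ((2 * π * ξ : ℝ) * Complex.I)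
      = phase β σ ξ * ((|2 * π * ξ| ^ (1 - β) : ℝ) : ℂ) := by
  have hξ' : 2 * π * ξ ≠ 0 := mul_ne_zero Real.two_pi_pos.ne' hξ
  have hσ0 : σ ≠ 0 := abs_pos.1 (hσ ▸ one_pos)
  have habs : |2 * π * (σ * ξ)| = |2 * π * ξ| := by
    rw [mul_left_comm, abs_mul, hσ, one_mul]
  have hsign (c : ℝ) (hc : 0 < c) : Real.sign (c * ξ) = Real.sign ξ := by
    rcases hξ.lt_or_gt with h | h
    · rw [Real.sign_of_neg h, Real.sign_of_neg (mul_neg_of_pos_of_neg hc h)]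
    · rw [Real.sign_of_pos h, Real.sign_of_pos (mul_pos hc h)]
  have hsignσ : Real.sign (2 * π * (σ * ξ)) = σ * Real.sign ξ := by
    rcases (abs_eq zero_le_one).1 hσ with rfl | rfl
    · rw [one_mul, one_mul, hsign _ Real.two_pi_pos]
    · rw [neg_one_mul, neg_one_mul, mul_neg, Real.sign_neg, hsign _ Real.two_pi_pos]
  have h1 := ofReal_mul_I_cpow (mul_ne_zero Real.two_pi_pos.ne' (mul_ne_zero hσ0 hξ)) (-β)
  have h2 := ofReal_mul_I_cpow hξ' 1
  rw [Complex.ofReal_one, Complex.cpow_one, Real.rpow_one] at h2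
  rw [← Complex.ofReal_neg, h1, h2, habs, hsignσ, hsign _ Real.two_pi_pos, sub_eq_neg_add,
    Real.rpow_add (abs_pos.2 hξ'), Real.rpow_one, phase,
    show Real.sign ξ * ((1 - σ * β) * (π / 2))
      = σ * Real.sign ξ * (-β * (π / 2)) + Real.sign ξ * (1 * (π / 2)) by ring]
  rw [Complex.ofReal_add, add_mul, Complex.exp_add, Complex.ofReal_mul (|_| ^ _)]
  ring

/-- The fractional integral of order `β` over the half line to the left (`σ = 1`) or to the right
(`σ = -1`) of `x`. -/
noncomputable def fracInt (β σ : ℝ) (f : ℝ → ℝ) (x : ℝ) : ℝ :=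
  1 / Real.Gamma β * ∫ y in Ioi (0 : ℝ), y ^ (β - 1) * f (x - σ * y)

/-- The element `p` of `L²(ℝ; ℝ) × L²(ℝ; ℂ)` is the image of the test function `φ`. -/
structure RepBy (s : ℝ) (p : L2Pair) (φ : ℝ → ℝ) : Prop where
  test : IsTest φ
  fst : p.fst =ᵐ[volume] φ
  snd : p.snd =ᵐ[volume] weightedFourier s φ

theorem exists_repBy {s : ℝ} (hs : 0 ≤ s) {φ : ℝ → ℝ} (h : IsTest φ) :
    ∃ u : H0 s, RepBy s u.1 φ := by
  have hfst : MemLp φ 2 volume := h.continuous.memLp_of_hasCompactSupport h.compact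
  have hsnd := memLp_weightedFourier hs h 2
  exact ⟨⟨WithLp.toLp 2 (hfst.toLp, hsnd.toLp), (testSpace s).le_topologicalClosure
    ⟨φ, h, hfst.coeFn_toLp, hsnd.coeFn_toLp⟩⟩, h, hfst.coeFn_toLp, hsnd.coeFn_toLp⟩

theorem H0.exists_seq {s : ℝ} (u : H0 s) :
    ∃ (w : ℕ → H0 s) (φ : ℕ → ℝ → ℝ), (∀ n, RepBy s (w n).1 (φ n)) ∧ Tendsto w atTop (𝓝 u) := by
  obtain ⟨p, hp, hlim⟩ := mem_closure_iff_seq_limit.1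
    (show u.1 ∈ closure (testSpace s : Set _) from u.2)
  choose φ htest hfst hsnd using hp
  exact ⟨fun n => ⟨p n, (testSpace s).le_topologicalClosure ⟨φ n, htest n, hfst n, hsnd n⟩⟩, φ,
    fun n => ⟨htest n, hfst n, hsnd n⟩, tendsto_subtype_rng.2 hlim⟩

theorem H0.induction {s : ℝ} {P : H0 s → Prop} (hP : IsClosed {u | P u})
    (h : ∀ (u : H0 s) (φ : ℝ → ℝ), RepBy s u.1 φ → P u) (u : H0 s) : P u := by
  obtain ⟨w, φ, hw, hlim⟩ := u.exists_seq
  exact hP.mem_of_tendsto hlim (Eventually.of_forall fun n => h _ _ (hw n))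

/-- The Fourier multiplier with symbol `phase β σ`, applied to the weighted Fourier transform; on
the images of test functions of order `1 - β` it realises `D I^β`. -/
noncomputable def fourierOp (β σ : ℝ) : L2Pair →L[ℝ] Lp ℂ 2 (volume : Measure ℝ) :=
  (((Lp.fourierTransformₗᵢ ℝ ℂ).symm.toContinuousLinearEquiv.toContinuousLinearMap ∘L
    mulLp (memLp_top_phase β σ)).restrictScalars ℝ) ∘L WithLp.sndL 2 ℝ _ _

theorem fourierOp_apply (β σ : ℝ) (p : L2Pair) :
    fourierOp β σ p = 𝓕⁻ (mulLp (memLp_top_phase β σ) p.snd) := rfl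

theorem coeFn_fourierOp {s : ℝ} (hs : 0 ≤ s) (β σ : ℝ) {p : L2Pair} {φ : ℝ → ℝ}
    (h : RepBy s p φ) :
    fourierOp β σ p =ᵐ[volume] 𝓕⁻ fun ξ => phase β σ ξ * weightedFourier s φ ξ := by
  have hmul : mulLp (memLp_top_phase β σ) p.snd
      =ᵐ[volume] fun ξ => phase β σ ξ * weightedFourier s φ ξ :=
    (coeFn_mulLp _ _).trans (h.snd.mono fun ξ hξ => by simp only [hξ])
  have hint : Integrable fun ξ => phase β σ ξ * weightedFourier s φ ξ :=
    (memLp_one_iff_integrable.1 (memLp_weightedFourier hs h.test 1)).bdd_mul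
      (measurable_phase β σ).aestronglyMeasurable
      (Eventually.of_forall fun ξ => (norm_phase β σ ξ).le)
  filter_upwards [coeFn_fourierInv_of_integrable _ (hint.congr hmul.symm)] with x hx
  rw [fourierOp_apply, hx, Real.fourierInv_congr_ae hmul]

section FracIntDeriv

variable {β σ : ℝ} {φ : ℝ → ℝ}

theorem IsTest.integrable_rpow_neg_mul_norm_fourier_deriv (hβ1 : β ≤ 1) (h : IsTest φ) :
    Integrable fun ξ : ℝ => |2 * π * ξ| ^ (-β) * ‖(𝓕 h.deriv.schwartz : 𝓢(ℝ, ℂ)) ξ‖ := by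
  refine (memLp_one_iff_integrable.1 (memLp_weightedFourier (sub_nonneg.2 hβ1) h 1)).norm.congr ?_
  filter_upwards [Measure.ae_ne volume 0] with ξ hξ
  have hr : 0 < |2 * π * ξ| := abs_pos.2 (mul_ne_zero Real.two_pi_pos.ne' hξ)
  rw [h.fourier_schwartz_deriv, weightedFourier, norm_mul, norm_mul, norm_mul, Complex.norm_I,
    mul_one, Complex.norm_real, Complex.norm_real, Real.norm_of_nonneg (by positivity),
    Real.norm_eq_abs, ← mul_assoc, sub_eq_neg_add, Real.rpow_add hr, Real.rpow_one]

theorem ofReal_fracInt_deriv (hσ : |σ| = 1) (hβ0 : 0 < β) (hβ1 : β ≤ 1) (h : IsTest φ) (x : ℝ) :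
    ((fracInt β σ (deriv φ) x : ℝ) : ℂ)
      = 𝓕⁻ (fun ξ => phase β σ ξ * weightedFourier (1 - β) φ ξ) x := by
  have hsymbol : (fun ξ : ℝ => ((2 * π * (σ * ξ) : ℝ) * Complex.I) ^ (-β : ℂ)
        * (𝓕 h.deriv.schwartz : 𝓢(ℝ, ℂ)) ξ)
      =ᵐ[volume] fun ξ => phase β σ ξ * weightedFourier (1 - β) φ ξ := by
    filter_upwards [Measure.ae_ne volume 0] with ξ hξ
    rw [h.fourier_schwartz_deriv, ← mul_assoc, cpow_mul_eq_phase_mul hσ β hξ, weightedFourier,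
      mul_assoc]
  have hint := integral_rpow_smul_comp_eq_fourierInv hσ hβ0 h.deriv.schwartz
    h.deriv.hasCompactSupport_ofReal (h.integrable_rpow_neg_mul_norm_fourier_deriv hβ1) x
  have hreal : (∫ y in Ioi (0 : ℝ), y ^ (β - 1) • h.deriv.schwartz (x - σ * y))
      = ((∫ y in Ioi (0 : ℝ), y ^ (β - 1) * deriv φ (x - σ * y) : ℝ) : ℂ) := by
    rw [← integral_complex_ofReal]
    simp only [IsTest.schwartz_apply, Complex.real_smul, Complex.ofReal_mul]
  rw [fracInt, Complex.ofReal_mul, ← hreal, hint, Real.fourierInv_congr_ae hsymbol, ← mul_assoc,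
    ← Complex.ofReal_mul, one_div_mul_cancel (Real.Gamma_pos_of_pos hβ0).ne', Complex.ofReal_one,
    one_mul]

theorem coeFn_fourierOp_eq_fracInt (hσ : |σ| = 1) (hβ0 : 0 < β) (hβ1 : β ≤ 1) {p : L2Pair}
    (h : RepBy (1 - β) p φ) :
    fourierOp β σ p =ᵐ[volume] fun x => ((fracInt β σ (deriv φ) x : ℝ) : ℂ) := by
  filter_upwards [coeFn_fourierOp (sub_nonneg.2 hβ1) β σ h] with x hx
  rw [hx, ofReal_fracInt_deriv hσ hβ0 hβ1 h.test]

theorem coeFn_fourierOp_zero (hσ : |σ| = 1) {p : L2Pair} (h : RepBy 1 p φ) :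
    fourierOp 0 σ p =ᵐ[volume] fun x => ((deriv φ x : ℝ) : ℂ) := by
  have hsymbol : (fun ξ => phase 0 σ ξ * weightedFourier 1 φ ξ)
      =ᵐ[volume] ⇑(𝓕 h.test.deriv.schwartz : 𝓢(ℝ, ℂ)) := by
    filter_upwards [Measure.ae_ne volume 0] with ξ hξ
    have hphase := cpow_mul_eq_phase_mul hσ 0 hξ
    rw [Complex.ofReal_zero, neg_zero, Complex.cpow_zero, one_mul, sub_zero] at hphase
    rw [h.test.fourier_schwartz_deriv, weightedFourier, hphase, mul_assoc (phase 0 σ ξ)]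
  filter_upwards [coeFn_fourierOp zero_le_one 0 σ h] with x hx
  rw [hx, Real.fourierInv_congr_ae hsymbol, ← SchwartzMap.fourierInv_coe,
    FourierTransform.fourierInv_fourier_eq, IsTest.schwartz_apply]

end FracIntDeriv

section InnerIntegral

variable {α : Type*} [MeasurableSpace α] {μ : Measure α}

theorem inner_eq_integral_of_ae {𝕜 E : Type*} [RCLike 𝕜] [NormedAddCommGroup E]
    [InnerProductSpace 𝕜 E] {f g : Lp E 2 μ} {a b : α → E} (hf : f =ᵐ[μ] a) (hg : g =ᵐ[μ] b) :
    inner 𝕜 f g = ∫ x, inner 𝕜 (a x) (b x) ∂μ := by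
  rw [L2.inner_def]
  refine integral_congr_ae ?_
  filter_upwards [hf, hg] with x hfx hgx
  rw [hfx, hgx]

theorem norm_sq_eq_integral_of_ae {E : Type*} [NormedAddCommGroup E] [InnerProductSpace ℝ E]
    {f : Lp E 2 μ} {a : α → E} (hf : f =ᵐ[μ] a) : ‖f‖ ^ 2 = ∫ x, ‖a x‖ ^ 2 ∂μ := by
  simp only [← real_inner_self_eq_norm_sq, inner_eq_integral_of_ae hf hf]

theorem inner_eq_integral_mul_of_ae {f g : Lp ℝ 2 μ} {a b : α → ℝ} (hf : f =ᵐ[μ] a)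
    (hg : g =ᵐ[μ] b) : inner ℝ f g = ∫ x, a x * b x ∂μ := by
  simp only [inner_eq_integral_of_ae hf hg, RCLike.inner_apply, conj_trivial, mul_comm]

theorem inner_eq_ofReal_integral_of_ae {f g : Lp ℂ 2 μ} {a b : α → ℝ}
    (hf : f =ᵐ[μ] fun x => (a x : ℂ)) (hg : g =ᵐ[μ] fun x => (b x : ℂ)) :
    inner ℂ f g = ((∫ x, a x * b x ∂μ : ℝ) : ℂ) := by
  rw [inner_eq_integral_of_ae hf hg, ← integral_complex_ofReal]
  simp only [RCLike.inner_apply, Complex.conj_ofReal, Complex.ofReal_mul, mul_comm]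

theorem sq_integral_mul_le {f g : α → ℝ} (hf : MemLp f 2 μ) (hg : MemLp g 2 μ) :
    (∫ x, f x * g x ∂μ) ^ 2 ≤ (∫ x, f x ^ 2 ∂μ) * ∫ x, g x ^ 2 ∂μ := by
  have h := real_inner_mul_inner_self_le hf.toLp hg.toLp
  simp only [inner_eq_integral_mul_of_ae hf.coeFn_toLp hg.coeFn_toLp,
    inner_eq_integral_mul_of_ae hf.coeFn_toLp hf.coeFn_toLp,
    inner_eq_integral_mul_of_ae hg.coeFn_toLp hg.coeFn_toLp, ← sq] at h
  exact h

end InnerIntegral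

namespace H0

variable {s : ℝ}

theorem continuous_fst : Continuous fun u : H0 s => u.1.fst :=
  (WithLp.fstL 2 ℝ _ _).continuous.comp continuous_subtype_val

theorem continuous_snd : Continuous fun u : H0 s => u.1.snd :=
  (WithLp.sndL 2 ℝ _ _).continuous.comp continuous_subtype_val

theorem norm_sq_eq (u : H0 s) : ‖u‖ ^ 2 = ‖u.1.fst‖ ^ 2 + ‖u.1.snd‖ ^ 2 :=
  WithLp.prod_norm_sq_eq_of_L2 u.1

end H0

namespace RepBy

variable {s : ℝ} {p : L2Pair} {φ : ℝ → ℝ}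

theorem norm_sq_fst (h : RepBy s p φ) : ‖p.fst‖ ^ 2 = ∫ x, φ x ^ 2 := by
  simp only [norm_sq_eq_integral_of_ae h.fst, Real.norm_eq_abs, sq_abs]

theorem norm_sq_snd (h : RepBy s p φ) : ‖p.snd‖ ^ 2 = ∫ ξ, ‖weightedFourier s φ ξ‖ ^ 2 :=
  norm_sq_eq_integral_of_ae h.snd

end RepBy

theorem norm_weightedFourier (s : ℝ) (φ : ℝ → ℝ) (ξ : ℝ) :
    ‖weightedFourier s φ ξ‖ = |2 * π * ξ| ^ s * ‖𝓕 (fun x : ℝ => (φ x : ℂ)) ξ‖ := by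
  rw [weightedFourier, norm_mul, Complex.norm_real, Real.norm_of_nonneg (by positivity)]

namespace IsTest

variable {φ : ℝ → ℝ}

theorem memLp (h : IsTest φ) (p : ℝ≥0∞) : MemLp φ p volume :=
  h.continuous.memLp_of_hasCompactSupport h.compact

theorem memLp_fourier (h : IsTest φ) (p : ℝ≥0∞) :
    MemLp (𝓕 fun x : ℝ => (φ x : ℂ)) p volume :=
  (𝓕 h.schwartz : 𝓢(ℝ, ℂ)).memLp p volume

theorem integrable_norm_sq_fourier (h : IsTest φ) :
    Integrable fun ξ => ‖𝓕 (fun x : ℝ => (φ x : ℂ)) ξ‖ ^ 2 :=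
  (h.memLp_fourier 2).integrable_norm_pow two_ne_zero

theorem integrable_norm_sq_weightedFourier {s : ℝ} (hs : 0 ≤ s) (h : IsTest φ) :
    Integrable fun ξ => ‖weightedFourier s φ ξ‖ ^ 2 :=
  (memLp_weightedFourier hs h 2).integrable_norm_pow two_ne_zero

theorem integral_norm_sq_fourier (h : IsTest φ) :
    ∫ ξ, ‖𝓕 (fun x : ℝ => (φ x : ℂ)) ξ‖ ^ 2 = ∫ x, φ x ^ 2 := by
  rw [← h.fourier_schwartz, SchwartzMap.integral_norm_sq_fourier]
  simp only [schwartz_apply, Complex.norm_real, Real.norm_eq_abs, sq_abs]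

theorem norm_sq_fourier_le (h : IsTest φ) (ξ : ℝ) :
    ‖𝓕 (fun x : ℝ => (φ x : ℂ)) ξ‖ ^ 2 ≤ ∫ x, φ x ^ 2 := by
  have hsupp (f : ℝ → ℝ) (hf : f 0 = 0) : ∫ x, f (φ x) = ∫ x in Ioo (0 : ℝ) 1, f (φ x) :=
    (setIntegral_eq_integral_of_forall_compl_eq_zero fun x hx => by rw [h.eq_zero hx, hf]).symm
  have hL1 : ‖𝓕 (fun x : ℝ => (φ x : ℂ)) ξ‖ ≤ ∫ x in Ioo (0 : ℝ) 1, |φ x| * 1 := by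
    refine (VectorFourier.norm_fourierIntegral_le_integral_norm Real.fourierChar volume
      (innerₗ ℝ) (fun x : ℝ => (φ x : ℂ)) ξ).trans_eq ?_
    simp only [Complex.norm_real, Real.norm_eq_abs, mul_one, hsupp (fun y => |y|) abs_zero]
  have hCS := sq_integral_mul_le ((h.memLp 2).restrict (Ioo 0 1)).abs
    (memLp_const (1 : ℝ) (μ := volume.restrict (Ioo (0 : ℝ) 1)))
  calc ‖𝓕 (fun x : ℝ => (φ x : ℂ)) ξ‖ ^ 2 ≤ (∫ x in Ioo (0 : ℝ) 1, |φ x| * 1) ^ 2 := by gcongr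
    _ ≤ ∫ x in Ioo (0 : ℝ) 1, φ x ^ 2 := by simpa using hCS
    _ = ∫ x, φ x ^ 2 := (hsupp (fun y => y ^ 2) (zero_pow two_ne_zero)).symm

theorem integral_sq_le {r : ℝ} (hr : 0 ≤ r) (h : IsTest φ) :
    ∫ x, φ x ^ 2 ≤ 2 * ∫ ξ, ‖weightedFourier r φ ξ‖ ^ 2 := by
  set N := ∫ x, φ x ^ 2
  set low : ℝ → ℝ := (Icc (-(1 / 4)) (1 / 4)).indicator fun _ => N with hlow_def
  have hlow : Integrable low := (integrable_indicator_iff measurableSet_Icc).2 (by simp)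
  have hlow_integral : ∫ ξ, low ξ = N / 2 := by
    rw [integral_indicator measurableSet_Icc, setIntegral_const]
    norm_num [Measure.real]
    ring
  -- Frequencies below `1/4` carry at most half of the energy; above, the weight is at least `1`.
  have hsplit (ξ : ℝ) :
      ‖𝓕 (fun x : ℝ => (φ x : ℂ)) ξ‖ ^ 2 ≤ low ξ + ‖weightedFourier r φ ξ‖ ^ 2 := by
    by_cases hξ : ξ ∈ Icc (-(1 / 4) : ℝ) (1 / 4)
    · rw [hlow_def, indicator_of_mem hξ]
      exact (h.norm_sq_fourier_le ξ).trans (le_add_of_nonneg_right (sq_nonneg _))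
    · rw [hlow_def, indicator_of_notMem hξ, zero_add, norm_weightedFourier]
      have hξ' : 1 / 4 < |ξ| := by rwa [mem_Icc, ← abs_le, not_le] at hξ
      gcongr
      refine le_mul_of_one_le_left (norm_nonneg _) (Real.one_le_rpow ?_ hr)
      rw [abs_mul, abs_of_pos Real.two_pi_pos]
      nlinarith [Real.pi_gt_three]
  have hwF := h.integrable_norm_sq_weightedFourier hr
  have := integral_mono h.integrable_norm_sq_fourier (hlow.add hwF) hsplit
  simp only [Pi.add_apply] at this
  rw [h.integral_norm_sq_fourier, integral_add hlow hwF, hlow_integral] at this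
  linarith

end IsTest

theorem norm_sq_fst_le {s : ℝ} (hs : 0 ≤ s) (u : H0 s) : ‖u.1.fst‖ ^ 2 ≤ 2 * ‖u.1.snd‖ ^ 2 := by
  refine H0.induction (P := fun u => ‖u.1.fst‖ ^ 2 ≤ 2 * ‖u.1.snd‖ ^ 2)
    (isClosed_le (H0.continuous_fst.norm.pow 2) ((H0.continuous_snd.norm.pow 2).const_mul 2))
    (fun u φ h => ?_) u
  rw [h.norm_sq_fst, h.norm_sq_snd]
  exact h.test.integral_sq_le hs

theorem norm_sq_le_snd {s : ℝ} (hs : 0 ≤ s) (u : H0 s) : ‖u‖ ^ 2 ≤ 3 * ‖u.1.snd‖ ^ 2 := by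
  linarith [u.norm_sq_eq, norm_sq_fst_le hs u]

/-- The real Hilbert space `L²(0,1)`. -/
abbrev L2Unit : Type := Lp ℝ 2 (volume.restrict (Ioo (0 : ℝ) 1))

/-- The operator `D I^β` from (the image of) `H^{1-β}_0(0,1)` to `L²(0,1)`, for the left (`σ = 1`)
or right (`σ = -1`) fractional integral; for `β = 0` the weak derivative. -/
noncomputable def derivOp (β σ : ℝ) : L2Pair →L[ℝ] L2Unit :=
  Complex.reCLM.compLpL 2 (volume.restrict (Ioo (0 : ℝ) 1)) ∘L
    LpToLpRestrictCLM ℝ ℂ ℝ volume 2 (Ioo (0 : ℝ) 1) ∘L fourierOp β σ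

theorem coeFn_derivOp_of_ae {β σ : ℝ} {p : L2Pair} {f : ℝ → ℝ}
    (h : fourierOp β σ p =ᵐ[volume] fun x => (f x : ℂ)) :
    derivOp β σ p =ᵐ[volume.restrict (Ioo (0 : ℝ) 1)] f := by
  filter_upwards [Complex.reCLM.coeFn_compLpL (p := 2) (μ := volume.restrict (Ioo (0 : ℝ) 1))
      (LpToLpRestrictCLM ℝ ℂ ℝ volume 2 (Ioo (0 : ℝ) 1) (fourierOp β σ p)),
    LpToLpRestrictCLM_coeFn ℝ (Ioo (0 : ℝ) 1) (fourierOp β σ p), ae_restrict_of_ae h]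
    with x hre hrestrict hx
  exact hre.trans (by rw [hrestrict, hx, Complex.reCLM_apply, Complex.ofReal_re])

theorem H0.continuous_derivOp {s : ℝ} (β σ : ℝ) : Continuous fun u : H0 s => derivOp β σ u.1 :=
  (derivOp β σ).continuous.comp continuous_subtype_val

section Energy

variable {β σ : ℝ} {p q : L2Pair} {φ : ℝ → ℝ}

theorem coeFn_derivOp (hσ : |σ| = 1) (hβ0 : 0 < β) (hβ1 : β ≤ 1) (h : RepBy (1 - β) p φ) :
    derivOp β σ p =ᵐ[volume.restrict (Ioo (0 : ℝ) 1)] fracInt β σ (deriv φ) :=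
  coeFn_derivOp_of_ae (coeFn_fourierOp_eq_fracInt hσ hβ0 hβ1 h)

theorem coeFn_derivOp_zero (hσ : |σ| = 1) (h : RepBy 1 p φ) :
    derivOp 0 σ p =ᵐ[volume.restrict (Ioo (0 : ℝ) 1)] deriv φ :=
  coeFn_derivOp_of_ae (coeFn_fourierOp_zero hσ h)

theorem re_inner_fourierOp (β σ β' σ' : ℝ) (p q : L2Pair) :
    (inner ℂ (fourierOp β σ p) (fourierOp β' σ' q)).re
      = ∫ ξ, (starRingEnd ℂ (phase β σ ξ) * phase β' σ' ξ
          * (starRingEnd ℂ (p.snd ξ) * q.snd ξ)).re := by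
  have hunitary : inner ℂ (fourierOp β σ p) (fourierOp β' σ' q)
      = inner ℂ (mulLp (memLp_top_phase β σ) p.snd) (mulLp (memLp_top_phase β' σ') q.snd) :=
    (Lp.fourierTransformₗᵢ ℝ ℂ).symm.inner_map_map _ _
  rw [hunitary, L2.inner_def, ← RCLike.re_eq_complex_re,
    ← integral_re (L2.integrable_inner (𝕜 := ℂ) _ _)]
  refine integral_congr_ae ?_
  filter_upwards [coeFn_mulLp (memLp_top_phase β σ) p.snd,
    coeFn_mulLp (memLp_top_phase β' σ') q.snd] with ξ hp hq
  rw [hp, hq, RCLike.inner_apply, map_mul (starRingEnd ℂ), RCLike.re_eq_complex_re]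
  congr 1
  ring

theorem conj_weightedFourier_mul_weightedFourier (s t : ℝ) (φ : ℝ → ℝ) {ξ : ℝ} (hξ : ξ ≠ 0) :
    starRingEnd ℂ (weightedFourier s φ ξ) * weightedFourier t φ ξ
      = ((‖weightedFourier ((s + t) / 2) φ ξ‖ ^ 2 : ℝ) : ℂ) := by
  have hr : 0 < |2 * π * ξ| := abs_pos.2 (mul_ne_zero Real.two_pi_pos.ne' hξ)
  have hpow : |2 * π * ξ| ^ s * |2 * π * ξ| ^ t = (|2 * π * ξ| ^ ((s + t) / 2)) ^ 2 := by
    rw [← Real.rpow_add hr, ← Real.rpow_mul_natCast hr.le]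
    congr 1
    push_cast; ring
  rw [norm_weightedFourier, mul_pow, ← hpow, weightedFourier, weightedFourier, map_mul,
    Complex.conj_ofReal, mul_mul_mul_comm, ← Complex.normSq_eq_conj_mul_self,
    Complex.normSq_eq_norm_sq, ← Complex.ofReal_mul, ← Complex.ofReal_mul]

theorem RepBy.inner_derivOp_derivOp {β' σ' s t : ℝ} (hp : RepBy s p φ) (hq : RepBy t q φ)
    {a b : ℝ → ℝ} (ha : fourierOp β σ p =ᵐ[volume] fun x => (a x : ℂ))
    (hb : fourierOp β' σ' q =ᵐ[volume] fun x => (b x : ℂ))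
    (hab : ∀ x ∉ Ioo (0 : ℝ) 1, a x * b x = 0) :
    inner ℝ (derivOp β σ p) (derivOp β' σ' q)
      = Real.cos (π * (σ * β - σ' * β') / 2)
        * ∫ ξ, ‖weightedFourier ((s + t) / 2) φ ξ‖ ^ 2 := by
  have hline : ∫ x, a x * b x = (inner ℂ (fourierOp β σ p) (fourierOp β' σ' q)).re := by
    rw [inner_eq_ofReal_integral_of_ae ha hb, Complex.ofReal_re]
  rw [inner_eq_integral_mul_of_ae (coeFn_derivOp_of_ae ha) (coeFn_derivOp_of_ae hb),
    setIntegral_eq_integral_of_forall_compl_eq_zero hab, hline, re_inner_fourierOp,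
    ← integral_const_mul]
  refine integral_congr_ae ?_
  filter_upwards [hp.snd, hq.snd, Measure.ae_ne volume 0] with ξ hpξ hqξ hξ
  rw [hpξ, hqξ, conj_weightedFourier_mul_weightedFourier s t φ hξ, Complex.re_mul_ofReal,
    re_conj_phase_mul_phase β σ β' σ' hξ]

theorem fracInt_one_eq_zero (h : IsTest φ) {x : ℝ} (hx : x ≤ 0) : fracInt β 1 φ x = 0 := by
  rw [fracInt, setIntegral_eq_zero_of_forall_eq_zero, mul_zero]
  intro y (hy : 0 < y)
  rw [h.eq_zero (fun hmem => by linarith [hmem.1]), mul_zero]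

theorem fracInt_neg_one_eq_zero (h : IsTest φ) {x : ℝ} (hx : 1 ≤ x) : fracInt β (-1) φ x = 0 := by
  rw [fracInt, setIntegral_eq_zero_of_forall_eq_zero, mul_zero]
  intro y (hy : 0 < y)
  rw [h.eq_zero (fun hmem => by linarith [hmem.2]), mul_zero]

theorem inner_derivOp_one_neg_one (hβ0 : 0 < β) (hβ1 : β ≤ 1) (u : H0 (1 - β)) :
    inner ℝ (derivOp β 1 u.1) (derivOp β (-1) u.1) = Real.cos (π * β) * ‖u.1.snd‖ ^ 2 := by
  refine H0.induction (P := fun u => inner ℝ (derivOp β 1 u.1) (derivOp β (-1) u.1)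
    = Real.cos (π * β) * ‖u.1.snd‖ ^ 2)
    (isClosed_eq ((H0.continuous_derivOp β 1).inner (H0.continuous_derivOp β (-1)))
      ((H0.continuous_snd.norm.pow 2).const_mul _)) (fun u φ h => ?_) u
  -- The left derivative is supported in `[0,∞)`, the right one in `(-∞,1]`.
  have hvanish (x : ℝ) (hx : x ∉ Ioo (0 : ℝ) 1) :
      fracInt β 1 (deriv φ) x * fracInt β (-1) (deriv φ) x = 0 := by
    rcases le_or_gt x 0 with h0 | h0
    · rw [fracInt_one_eq_zero h.test.deriv h0, zero_mul]
    · rw [fracInt_neg_one_eq_zero h.test.deriv (not_lt.1 fun h' => hx ⟨h0, h'⟩), mul_zero]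
  rw [h.inner_derivOp_derivOp h (coeFn_fourierOp_eq_fracInt abs_one hβ0 hβ1 h)
      (coeFn_fourierOp_eq_fracInt (by simp) hβ0 hβ1 h) hvanish,
    h.norm_sq_snd, add_self_div_two]
  congr 2
  ring

theorem RepBy.inner_derivOp_derivOp_zero (hσ : |σ| = 1) (hβ0 : 0 < β) (hβ1 : β ≤ 1)
    (hp : RepBy (1 - β) p φ) (hq : RepBy 1 q φ) :
    inner ℝ (derivOp β σ p) (derivOp 0 1 q)
      = Real.cos (π * β / 2) * ∫ ξ, ‖weightedFourier (1 - β / 2) φ ξ‖ ^ 2 := by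
  have hcos : Real.cos (π * (σ * β - 1 * 0) / 2) = Real.cos (π * β / 2) := by
    rcases (abs_eq zero_le_one).1 hσ with rfl | rfl
    · congr 1; ring
    · rw [← Real.cos_neg]; congr 1; ring
  rw [hp.inner_derivOp_derivOp hq (coeFn_fourierOp_eq_fracInt hσ hβ0 hβ1 hp)
      (coeFn_fourierOp_zero abs_one hq)
      (fun x hx => by rw [hp.test.deriv.eq_zero hx, mul_zero]), hcos,
    show (1 - β + 1) / 2 = 1 - β / 2 by ring]

end Energy

section FractionalIntegral

variable {β σ : ℝ} {φ : ℝ → ℝ}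

theorem hasDerivAt_fracInt (hσ : |σ| = 1) (hβ : 0 < β) (h : IsTest φ) (x : ℝ) :
    HasDerivAt (fracInt β σ φ) (fracInt β σ (deriv φ) x) x := by
  obtain ⟨M, R, hbound⟩ :=
    exists_norm_rpow_smul_comp_le h.deriv.continuous h.deriv.compact hσ β (|x| + 1)
  have hmeas {f : ℝ → ℝ} (hf : Continuous f) (z : ℝ) : AEStronglyMeasurable
      (fun y : ℝ => y ^ (β - 1) * f (z - σ * y)) (volume.restrict (Ioi 0)) :=
    (Measurable.aestronglyMeasurable (by fun_prop)).mul
      (by fun_prop : Continuous fun y : ℝ => f (z - σ * y)).aestronglyMeasurable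
  refine (hasDerivAt_integral_of_dominated_loc_of_deriv_le (Metric.ball_mem_nhds x one_pos)
    (F' := fun z y => y ^ (β - 1) * deriv φ (z - σ * y))
    (Eventually.of_forall (hmeas h.continuous))
    (integrableOn_rpow_smul_comp h.continuous h.compact hσ hβ x)
    (hmeas h.deriv.continuous x) ?_
    (integrable_indicator_const_mul_rpow hβ M R).integrableOn ?_).2.const_mul _
  · filter_upwards [ae_restrict_mem measurableSet_Ioi] with y hy z hz
    refine hbound z ?_ y hy
    rw [Metric.mem_ball, Real.dist_eq] at hz
    linarith [abs_sub_abs_le_abs_sub z x]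
  · refine Eventually.of_forall fun y z _ => ?_
    simpa using
      ((h.hasDerivAt (z - σ * y)).comp z ((hasDerivAt_id z).sub_const (σ * y))).const_mul
        (y ^ (β - 1))

theorem integral_fracInt_deriv (hσ : |σ| = 1) (hβ : 0 < β) (h : IsTest φ) (a b : ℝ) :
    ∫ t in a..b, fracInt β σ (deriv φ) t = fracInt β σ φ b - fracInt β σ φ a := by
  have hcont : Continuous (fracInt β σ (deriv φ)) :=
    continuous_iff_continuousAt.2 fun x => (hasDerivAt_fracInt hσ hβ h.deriv x).continuousAt
  exact intervalIntegral.integral_eq_sub_of_hasDerivAt (fun x _ => hasDerivAt_fracInt hσ hβ h x)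
    (hcont.intervalIntegrable a b)

theorem leftInt_eq_fracInt (h : IsTest φ) (x : ℝ) : leftInt β φ x = fracInt β 1 φ x := by
  have hextend : ∫ s in Ioo 0 x, φ s / (x - s) ^ (1 - β)
      = ∫ s in Iio x, φ s / (x - s) ^ (1 - β) :=
    (setIntegral_eq_of_subset_of_forall_sdiff_eq_zero measurableSet_Iio Ioo_subset_Iio_self
      fun s hs => by rw [h.eq_zero fun hmem => hs.2 ⟨hmem.1, hs.1⟩, zero_div]).symm
  rw [leftInt, fracInt, hextend,
    ← (volume.measurePreserving_sub_left x).setIntegral_preimage_emb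
      (MeasurableEquiv.subLeft x).measurableEmbedding,
    preimage_const_sub_Iio, sub_self]
  congr 1
  refine setIntegral_congr_fun measurableSet_Ioi fun y (hy : 0 < y) => ?_
  rw [sub_sub_cancel, one_mul, ← neg_sub β, Real.rpow_neg hy.le, div_inv_eq_mul, mul_comm]

theorem rightInt_eq_fracInt (h : IsTest φ) (x : ℝ) : rightInt β φ x = fracInt β (-1) φ x := by
  have hextend : ∫ s in Ioo x 1, φ s / (s - x) ^ (1 - β)
      = ∫ s in Ioi x, φ s / (s - x) ^ (1 - β) :=
    (setIntegral_eq_of_subset_of_forall_sdiff_eq_zero measurableSet_Ioi Ioo_subset_Ioi_self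
      fun s hs => by rw [h.eq_zero fun hmem => hs.2 ⟨hs.1, hmem.2⟩, zero_div]).symm
  rw [rightInt, fracInt, hextend,
    ← (measurePreserving_add_left volume x).setIntegral_preimage_emb
      (MeasurableEquiv.addLeft x).measurableEmbedding,
    preimage_const_add_Ioi, sub_self]
  congr 1
  refine setIntegral_congr_fun measurableSet_Ioi fun y (hy : 0 < y) => ?_
  rw [add_sub_cancel_left, neg_one_mul, sub_neg_eq_add, ← neg_sub β, Real.rpow_neg hy.le,
    div_inv_eq_mul, mul_comm]

end FractionalIntegral

section SobolevEmbedding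

variable {s : ℝ}

theorem memLp_one_add_abs_rpow_neg (hs : 1 / 2 < s) :
    MemLp (fun ξ : ℝ => (1 + |ξ|) ^ (-s)) 2 volume := by
  rw [memLp_two_iff_integrable_sq (Measurable.aestronglyMeasurable (by fun_prop))]
  refine (integrable_one_add_norm (E := ℝ) (r := 2 * s) (by simp; linarith)).congr
    (Eventually.of_forall fun ξ => ?_)
  simp only [Real.norm_eq_abs]
  rw [← Real.rpow_mul_natCast (by positivity)]
  congr 1
  push_cast; ring

theorem IsTest.abs_le_integral_norm_fourier {φ : ℝ → ℝ} (h : IsTest φ) (x : ℝ) :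
    |φ x| ≤ ∫ ξ, ‖𝓕 (fun y : ℝ => (φ y : ℂ)) ξ‖ := by
  have hinv : 𝓕⁻ (𝓕 fun y : ℝ => (φ y : ℂ)) x = φ x := by
    rw [← h.fourier_schwartz, ← SchwartzMap.fourierInv_coe,
      FourierTransform.fourierInv_fourier_eq, h.schwartz_apply]
  rw [← Real.norm_eq_abs, ← Complex.norm_real, ← hinv]
  exact VectorFourier.norm_fourierIntegral_le_integral_norm Real.fourierChar volume
    (-innerₗ ℝ) _ x

theorem norm_fourier_le_mul_norm_add_norm_weightedFourier (hs : 0 ≤ s) (φ : ℝ → ℝ) (ξ : ℝ) :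
    ‖𝓕 (fun y : ℝ => (φ y : ℂ)) ξ‖
      ≤ 2 ^ s * ((1 + |ξ|) ^ (-s)
        * (‖𝓕 (fun y : ℝ => (φ y : ℂ)) ξ‖ + ‖weightedFourier s φ ξ‖)) := by
  have hpow : (1 + |ξ|) ^ s ≤ 2 ^ s * (1 + |2 * π * ξ| ^ s) := by
    have hmax : 1 + |ξ| ≤ 2 * max 1 |2 * π * ξ| := by
      have hξ : |ξ| ≤ |2 * π * ξ| := by
        rw [abs_mul, abs_of_pos Real.two_pi_pos]
        nlinarith [Real.pi_gt_three, abs_nonneg ξ]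
      linarith [le_max_left 1 |2 * π * ξ|, le_max_right 1 |2 * π * ξ|]
    calc (1 + |ξ|) ^ s ≤ (2 * max 1 |2 * π * ξ|) ^ s := by gcongr
      _ = 2 ^ s * max 1 |2 * π * ξ| ^ s := Real.mul_rpow zero_le_two (by positivity)
      _ ≤ 2 ^ s * (1 + |2 * π * ξ| ^ s) := by
        gcongr
        rcases max_cases 1 |2 * π * ξ| with ⟨h, -⟩ | ⟨h, -⟩ <;> rw [h]
        · rw [Real.one_rpow]
          exact le_add_of_nonneg_right (by positivity)
        · exact le_add_of_nonneg_left zero_le_one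
  rw [norm_weightedFourier, Real.rpow_neg (by positivity), mul_left_comm, inv_mul_eq_div,
    le_div_iff₀ (by positivity)]
  nlinarith [norm_nonneg (𝓕 (fun y : ℝ => (φ y : ℂ)) ξ)]

theorem exists_abs_le_of_repBy (hs : 1 / 2 < s) :
    ∃ C : ℝ, ∀ (u : H0 s) (φ : ℝ → ℝ), RepBy s u.1 φ → ∀ x, |φ x| ≤ C * ‖u‖ := by
  set k : ℝ → ℝ := fun ξ => (1 + |ξ|) ^ (-s)
  have hs0 : 0 ≤ s := by linarith
  have hk : MemLp k 2 volume := memLp_one_add_abs_rpow_neg hs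
  refine ⟨2 ^ s * √((∫ ξ, k ξ ^ 2) * 2), fun u φ h x => ?_⟩
  set F : ℝ → ℂ := 𝓕 fun x : ℝ => (φ x : ℂ)
  set w := weightedFourier s φ
  have hsum : MemLp (fun ξ => ‖F ξ‖ + ‖w ξ‖) 2 volume :=
    (h.test.memLp_fourier 2).norm.add (memLp_weightedFourier hs0 h.test 2).norm
  have hFsq := h.test.integrable_norm_sq_fourier
  have hwsq := h.test.integrable_norm_sq_weightedFourier hs0
  have hL1 : ∫ ξ, ‖F ξ‖ ≤ 2 ^ s * ∫ ξ, k ξ * (‖F ξ‖ + ‖w ξ‖) := by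
    rw [← integral_const_mul]
    exact integral_mono (memLp_one_iff_integrable.1 (h.test.memLp_fourier 1)).norm
      ((hk.integrable_mul hsum).const_mul _)
      (norm_fourier_le_mul_norm_add_norm_weightedFourier hs0 φ)
  have henergy : ∫ ξ, (‖F ξ‖ + ‖w ξ‖) ^ 2 ≤ 2 * ‖u‖ ^ 2 := by
    rw [u.norm_sq_eq, h.norm_sq_fst, h.norm_sq_snd, ← h.test.integral_norm_sq_fourier,
      ← integral_add hFsq hwsq, ← integral_const_mul]
    exact integral_mono hsum.integrable_sq ((hFsq.add hwsq).const_mul 2) fun ξ => add_sq_le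
  have hCS : ∫ ξ, k ξ * (‖F ξ‖ + ‖w ξ‖) ≤ √((∫ ξ, k ξ ^ 2) * 2) * ‖u‖ := by
    rw [← Real.sqrt_sq (norm_nonneg u),
      ← Real.sqrt_mul (mul_nonneg (integral_nonneg fun ξ => sq_nonneg _) zero_le_two), mul_assoc]
    refine Real.le_sqrt_of_sq_le ((sq_integral_mul_le hk hsum).trans ?_)
    exact mul_le_mul_of_nonneg_left henergy (integral_nonneg fun ξ => sq_nonneg _)
  calc |φ x| ≤ ∫ ξ, ‖F ξ‖ := h.test.abs_le_integral_norm_fourier x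
    _ ≤ 2 ^ s * (√((∫ ξ, k ξ ^ 2) * 2) * ‖u‖) := hL1.trans (by gcongr)
    _ = 2 ^ s * √((∫ ξ, k ξ ^ 2) * 2) * ‖u‖ := (mul_assoc _ _ _).symm

theorem exists_ae_abs_fn_le (hs : 1 / 2 < s) :
    ∃ C : ℝ, ∀ u : H0 s, ∀ᵐ x, |u.fn x| ≤ C * ‖u‖ := by
  obtain ⟨C, hbound⟩ := exists_abs_le_of_repBy hs
  refine ⟨C, fun u => ?_⟩
  obtain ⟨w, φ, hw, hlim⟩ := u.exists_seq
  obtain ⟨ns, hns, hae⟩ := (tendstoInMeasure_of_tendsto_Lp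
    ((H0.continuous_fst.tendsto u).comp hlim)).exists_seq_tendsto_ae
  filter_upwards [hae, ae_all_iff.2 fun n => (hw n).fst] with x hx hwx
  refine le_of_tendsto_of_tendsto hx.abs ((hlim.norm.comp hns.tendsto_atTop).const_mul C)
    (Eventually.of_forall fun n => ?_)
  simp only [Function.comp_apply, hwx]
  exact hbound _ _ (hw _) x

theorem continuous_setIntegral_fn_mul (hs : 1 / 2 < s) {S : Set ℝ} {k : ℝ → ℝ}
    (hk : IntegrableOn k S) : Continuous fun u : H0 s => ∫ x in S, u.fn x * k x := by
  obtain ⟨C, hbound⟩ := exists_ae_abs_fn_le hs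
  have hint (u : H0 s) : IntegrableOn (fun x => u.fn x * k x) S :=
    hk.bdd_mul (c := C * ‖u‖) (Lp.aestronglyMeasurable u.1.fst).restrict
      (ae_restrict_of_ae (hbound u))
  have hlip (u v : H0 s) : dist (∫ x in S, u.fn x * k x) (∫ x in S, v.fn x * k x)
      ≤ (C * ∫ x in S, ‖k x‖) * dist u v := by
    rw [dist_eq_norm, dist_eq_norm, ← integral_sub (hint u) (hint v), mul_right_comm,
      ← integral_const_mul]
    refine norm_integral_le_of_norm_le (hk.norm.const_mul _) (ae_restrict_of_ae ?_)
    filter_upwards [hbound (u - v), Lp.coeFn_sub u.1.fst v.1.fst] with x hx hsub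
    rw [← sub_mul, norm_mul]
    have hfn : (u - v).fn x = u.fn x - v.fn x := hsub
    rw [hfn] at hx
    exact mul_le_mul_of_nonneg_right hx (norm_nonneg _)
  exact (LipschitzWith.of_dist_le' hlip).continuous

variable {β : ℝ}

theorem continuous_leftInt (hβ0 : 0 < β) (hβ1 : β < 1 / 2) {x : ℝ} (hx : 0 ≤ x) :
    Continuous fun u : H0 (1 - β) => leftInt β u.fn x := by
  have hkernel : IntegrableOn (fun s => ((x - s) ^ (1 - β))⁻¹) (Ioo 0 x) := by
    have hrpow : IntervalIntegrable (fun s : ℝ => (x - s) ^ (β - 1)) volume 0 x := by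
      simpa using ((intervalIntegral.intervalIntegrable_rpow' (a := 0) (b := x)
        (r := β - 1) (by linarith)).comp_sub_left x).symm
    refine ((intervalIntegrable_iff_integrableOn_Ioo_of_le hx).1 hrpow).congr_fun
      (fun s hs => ?_) measurableSet_Ioo
    rw [← Real.rpow_neg (sub_nonneg.2 hs.2.le), neg_sub]
  simpa only [leftInt, div_eq_mul_inv] using
    (continuous_setIntegral_fn_mul (by linarith) hkernel).const_mul (1 * (Real.Gamma β)⁻¹)

theorem continuous_rightInt (hβ0 : 0 < β) (hβ1 : β < 1 / 2) {x : ℝ} (hx : x ≤ 1) :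
    Continuous fun u : H0 (1 - β) => rightInt β u.fn x := by
  have hkernel : IntegrableOn (fun s => ((s - x) ^ (1 - β))⁻¹) (Ioo x 1) := by
    have hrpow : IntervalIntegrable (fun s : ℝ => (s - x) ^ (β - 1)) volume x 1 := by
      simpa using (intervalIntegral.intervalIntegrable_rpow' (a := 0) (b := 1 - x)
        (r := β - 1) (by linarith)).comp_sub_right x
    refine ((intervalIntegrable_iff_integrableOn_Ioo_of_le hx).1 hrpow).congr_fun
      (fun s hs => ?_) measurableSet_Ioo
    rw [← Real.rpow_neg (sub_nonneg.2 hs.1.le), neg_sub]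
  simpa only [rightInt, div_eq_mul_inv] using
    (continuous_setIntegral_fn_mul (by linarith) hkernel).const_mul (1 * (Real.Gamma β)⁻¹)

end SobolevEmbedding

section Primitive

variable {a b : ℝ}

theorem intervalIntegral_eq_setIntegral_Ioo_unit (ha : 0 ≤ a) (hab : a ≤ b) (hb : b ≤ 1)
    (f : ℝ → ℝ) :
    ∫ t in a..b, f t = ∫ t in Ioo a b, f t ∂(volume.restrict (Ioo (0 : ℝ) 1)) := by
  rw [intervalIntegral.integral_of_le hab, integral_Ioc_eq_integral_Ioo,
    Measure.restrict_restrict measurableSet_Ioo, inter_eq_left.2 (Ioo_subset_Ioo ha hb)]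

theorem intervalIntegral_congr_of_ae_unit (ha : 0 ≤ a) (hab : a ≤ b) (hb : b ≤ 1) {f g : ℝ → ℝ}
    (h : f =ᵐ[volume.restrict (Ioo (0 : ℝ) 1)] g) : ∫ t in a..b, f t = ∫ t in a..b, g t := by
  rw [intervalIntegral_eq_setIntegral_Ioo_unit ha hab hb,
    intervalIntegral_eq_setIntegral_Ioo_unit ha hab hb]
  exact integral_congr_ae (ae_restrict_of_ae h)

namespace L2Unit

theorem integrableOn (f : L2Unit) : IntegrableOn f (Ioo 0 1) :=
  (Lp.memLp f).integrable one_le_two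

theorem intervalIntegrable (f : L2Unit) (ha : a ∈ Icc (0 : ℝ) 1) (hb : b ∈ Icc (0 : ℝ) 1) :
    IntervalIntegrable f volume a b :=
  ((intervalIntegrable_iff_integrableOn_Ioo_of_le zero_le_one).2 f.integrableOn).mono_set
    (uIcc_subset_uIcc (by rwa [uIcc_of_le zero_le_one]) (by rwa [uIcc_of_le zero_le_one]))

theorem continuous_intervalIntegral (ha : 0 ≤ a) (hab : a ≤ b) (hb : b ≤ 1) :
    Continuous fun f : L2Unit => ∫ t in a..b, f t := by
  simp only [intervalIntegral_eq_setIntegral_Ioo_unit ha hab hb,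
    ← L2.inner_indicatorConstLp_one (𝕜 := ℝ) measurableSet_Ioo (measure_ne_top _ _)]
  fun_prop

end L2Unit

variable {β : ℝ}

theorem leftInt_congr_ae {f g : ℝ → ℝ} (h : f =ᵐ[volume] g) (x : ℝ) :
    leftInt β f x = leftInt β g x := by
  rw [leftInt, leftInt]
  congr 1
  exact integral_congr_ae (ae_restrict_of_ae (h.mono fun y hy => by simp only [hy]))

theorem rightInt_congr_ae {f g : ℝ → ℝ} (h : f =ᵐ[volume] g) (x : ℝ) :
    rightInt β f x = rightInt β g x := by
  rw [rightInt, rightInt]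
  congr 1
  exact integral_congr_ae (ae_restrict_of_ae (h.mono fun y hy => by simp only [hy]))

theorem leftInt_eq_integral_derivOp (hβ0 : 0 < β) (hβ1 : β < 1 / 2) (u : H0 (1 - β))
    {x : ℝ} (hx : x ∈ Icc (0 : ℝ) 1) :
    leftInt β u.fn x = ∫ t in (0 : ℝ)..x, derivOp β 1 u.1 t := by
  refine H0.induction (P := fun u => leftInt β u.fn x = ∫ t in (0 : ℝ)..x, derivOp β 1 u.1 t)
    (isClosed_eq (continuous_leftInt hβ0 hβ1 hx.1)
      ((L2Unit.continuous_intervalIntegral le_rfl hx.1 hx.2).comp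
        (H0.continuous_derivOp β 1))) (fun u φ h => ?_) u
  rw [H0.fn, leftInt_congr_ae h.fst, leftInt_eq_fracInt h.test,
    intervalIntegral_congr_of_ae_unit le_rfl hx.1 hx.2
      (coeFn_derivOp abs_one hβ0 (by linarith) h),
    integral_fracInt_deriv abs_one hβ0 h.test, fracInt_one_eq_zero h.test le_rfl, sub_zero]

theorem rightInt_eq_integral_derivOp (hβ0 : 0 < β) (hβ1 : β < 1 / 2) (u : H0 (1 - β))
    {x : ℝ} (hx : x ∈ Icc (0 : ℝ) 1) :
    rightInt β u.fn x = -∫ t in x..1, derivOp β (-1) u.1 t := by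
  have habs : |(-1 : ℝ)| = 1 := by rw [abs_neg, abs_one]
  refine H0.induction (P := fun u => rightInt β u.fn x = -∫ t in x..1, derivOp β (-1) u.1 t)
    (isClosed_eq (continuous_rightInt hβ0 hβ1 hx.2)
      ((L2Unit.continuous_intervalIntegral hx.1 hx.2 le_rfl).comp
        (H0.continuous_derivOp β (-1))).neg) (fun u φ h => ?_) u
  rw [H0.fn, rightInt_congr_ae h.fst, rightInt_eq_fracInt h.test,
    intervalIntegral_congr_of_ae_unit hx.1 hx.2 le_rfl
      (coeFn_derivOp habs hβ0 (by linarith) h),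
    integral_fracInt_deriv habs hβ0 h.test, fracInt_neg_one_eq_zero h.test le_rfl, zero_sub,
    neg_neg]

end Primitive

section WeakDerivative

variable {φ ψ w w' g g' : ℝ → ℝ}

theorem IsTest.integral_deriv (h : IsTest φ) : ∫ x in (0 : ℝ)..1, _root_.deriv φ x = 0 := by
  rw [intervalIntegral.integral_deriv_eq_sub (fun x _ => (h.hasDerivAt x).differentiableAt)
    (h.deriv.continuous.intervalIntegrable 0 1), h.eq_zero (x := 1) (by simp),
    h.eq_zero (x := 0) (by simp), sub_zero]

theorem intervalIntegrable_unit_iff {f : ℝ → ℝ} :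
    IntervalIntegrable f volume 0 1 ↔ IntegrableOn f (Ioo 0 1) :=
  intervalIntegrable_iff_integrableOn_Ioo_of_le zero_le_one

theorem setIntegral_Ioo_unit_eq (f : ℝ → ℝ) :
    ∫ x in Ioo (0 : ℝ) 1, f x = ∫ x in (0 : ℝ)..1, f x := by
  rw [intervalIntegral.integral_of_le zero_le_one, integral_Ioc_eq_integral_Ioo]

theorem continuousOn_primitive_unit (hg : IntegrableOn g (Ioo 0 1)) (c : ℝ) :
    ContinuousOn (fun x => c + ∫ t in (0 : ℝ)..x, g t) (Icc 0 1) := by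
  have hg' := intervalIntegrable_unit_iff.2 hg
  have h := (hg'.absolutelyContinuousOnInterval_intervalIntegral (c := 0) (by simp)).continuousOn
  rw [uIcc_of_le zero_le_one] at h
  exact continuousOn_const.add h

theorem integral_primitive_mul_deriv (hg : IntegrableOn g (Ioo 0 1)) (hφ : IsTest φ) :
    ∫ x in (0 : ℝ)..1, (∫ t in (0 : ℝ)..x, g t) * deriv φ x
      = -∫ x in (0 : ℝ)..1, g x * φ x := by
  have hg' := intervalIntegrable_unit_iff.2 hg
  have hP := hg'.absolutelyContinuousOnInterval_intervalIntegral (c := 0) (by simp)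
  have hφac : AbsolutelyContinuousOnInterval φ 0 1 :=
    (hφ.smooth.of_le (by simp)).contDiffOn.absolutelyContinuousOnInterval
  rw [hP.integral_mul_deriv_eq_deriv_mul hφac, hφ.eq_zero (x := 1) (by simp),
    hφ.eq_zero (x := 0) (by simp), mul_zero, mul_zero, sub_zero, zero_sub]
  refine congrArg Neg.neg (intervalIntegral.integral_congr_ae ?_)
  filter_upwards [hg'.ae_hasDerivAt_integral] with x hx hmem
  rw [(hx (uIoc_subset_uIcc hmem) 0 (by simp)).deriv]

theorem hasWeakDeriv_primitive (hg : IntegrableOn g (Ioo 0 1)) (c : ℝ) :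
    HasWeakDeriv (fun x => c + ∫ t in (0 : ℝ)..x, g t) g := by
  refine ⟨?_, hg.locallyIntegrableOn, fun φ hφ => ?_⟩
  · exact ((continuousOn_primitive_unit hg c).mono Ioo_subset_Icc_self).locallyIntegrableOn
      measurableSet_Ioo
  have hPφ : IntervalIntegrable (fun x => (∫ t in (0 : ℝ)..x, g t) * deriv φ x) volume 0 1 := by
    have hP := continuousOn_primitive_unit hg 0
    simp only [zero_add] at hP
    exact (hP.mul hφ.deriv.continuous.continuousOn).intervalIntegrable_of_Icc zero_le_one
  simp only [setIntegral_Ioo_unit_eq, add_mul]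
  rw [intervalIntegral.integral_add
      ((hφ.deriv.continuous.intervalIntegrable 0 1).const_mul c) hPφ,
    intervalIntegral.integral_const_mul, hφ.integral_deriv, mul_zero, zero_add,
    integral_primitive_mul_deriv hg hφ]

theorem HasWeakDeriv.congr_ae (h : HasWeakDeriv w g)
    (hw : w =ᵐ[volume.restrict (Ioo (0 : ℝ) 1)] w')
    (hg : g =ᵐ[volume.restrict (Ioo (0 : ℝ) 1)] g') : HasWeakDeriv w' g' := by
  have hloc {f f' : ℝ → ℝ} (hf : LocallyIntegrableOn f (Ioo (0 : ℝ) 1))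
      (hff' : f =ᵐ[volume.restrict (Ioo (0 : ℝ) 1)] f') :
      LocallyIntegrableOn f' (Ioo (0 : ℝ) 1) := by
    rw [locallyIntegrableOn_iff isOpen_Ioo.isLocallyClosed] at hf ⊢
    exact fun k hk hkc => (hf k hk hkc).congr (ae_restrict_of_ae_restrict_of_subset hk hff')
  refine ⟨hloc h.1 hw, hloc h.2.1 hg, fun φ hφ => ?_⟩
  calc ∫ x in Ioo (0 : ℝ) 1, w' x * deriv φ x
      = ∫ x in Ioo (0 : ℝ) 1, w x * deriv φ x :=
        (integral_congr_ae (hw.mul (ae_eq_refl (deriv φ)))).symm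
    _ = -∫ x in Ioo (0 : ℝ) 1, g x * φ x := h.2.2 φ hφ
    _ = -∫ x in Ioo (0 : ℝ) 1, g' x * φ x :=
        congrArg Neg.neg (integral_congr_ae (hg.mul (ae_eq_refl φ)))

theorem IsTest.hasWeakDeriv (h : IsTest φ) : HasWeakDeriv φ (_root_.deriv φ) := by
  refine (hasWeakDeriv_primitive (h.deriv.continuous.integrableOn_Icc.mono_set
    Ioo_subset_Icc_self) 0).congr_ae (Eventually.of_forall fun x => ?_) (ae_eq_refl _)
  simp only [intervalIntegral.integral_deriv_eq_sub
    (fun x _ => (h.hasDerivAt x).differentiableAt) (h.deriv.continuous.intervalIntegrable 0 x),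
    h.eq_zero (x := 0) (by simp), zero_add, sub_zero]

theorem memH1_primitive (g : L2Unit) (c : ℝ) : MemH1 fun x => c + ∫ t in (0 : ℝ)..x, g t := by
  have hcont := continuousOn_primitive_unit g.integrableOn c
  refine ⟨?_, g, hasWeakDeriv_primitive g.integrableOn c, Lp.memLp g⟩
  obtain ⟨C, hC⟩ := isCompact_Icc.exists_bound_of_continuousOn hcont
  refine MemLp.of_bound
    ((hcont.mono Ioo_subset_Icc_self).aestronglyMeasurable measurableSet_Ioo) C ?_
  filter_upwards [ae_restrict_mem measurableSet_Ioo] with x hx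
  exact hC x (Ioo_subset_Icc_self hx)

theorem MemH1.congr_ae (h : MemH1 w) (hw : w =ᵐ[volume.restrict (Ioo (0 : ℝ) 1)] w') :
    MemH1 w' := by
  obtain ⟨hw2, g, hg, hg2⟩ := h
  exact ⟨hw2.ae_eq hw, g, hg.congr_ae hw (ae_eq_refl g), hg2⟩

theorem ae_eq_zero_of_forall_integral_mul_test {f : ℝ → ℝ}
    (hf : LocallyIntegrableOn f (Ioo (0 : ℝ) 1))
    (h : ∀ φ, IsTest φ → ∫ x in Ioo (0 : ℝ) 1, f x * φ x = 0) :
    f =ᵐ[volume.restrict (Ioo (0 : ℝ) 1)] 0 := by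
  refine (ae_restrict_iff' measurableSet_Ioo).2
    (isOpen_Ioo.ae_eq_zero_of_integral_contDiff_smul_eq_zero hf fun φ hsmooth hcompact hsupp => ?_)
  have hφ : IsTest φ := ⟨hsmooth, hcompact, hsupp⟩
  rw [← h φ hφ, ← setIntegral_eq_integral_of_forall_compl_eq_zero (s := Ioo (0 : ℝ) 1)
    fun x hx => by rw [hφ.eq_zero hx, zero_smul]]
  simp only [smul_eq_mul, mul_comm]

theorem IsTest.integrableOn_mul (h : IsTest φ) {f : ℝ → ℝ}
    (hf : LocallyIntegrableOn f (Ioo (0 : ℝ) 1)) :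
    IntegrableOn (fun x => f x * φ x) (Ioo 0 1) := by
  have hsupp : IntegrableOn (fun x => f x * φ x) (tsupport φ) :=
    (hf.integrableOn_compact_subset h.supp h.compact).mul_continuousOn
      h.continuous.continuousOn h.compact
  exact ((integrableOn_iff_integrable_of_support_subset
    ((Function.support_mul_subset_right f φ).trans (subset_tsupport φ))).1 hsupp).integrableOn

theorem ae_eq_of_forall_integral_mul_test {f f' : ℝ → ℝ}
    (hf : LocallyIntegrableOn f (Ioo (0 : ℝ) 1)) (hf' : LocallyIntegrableOn f' (Ioo (0 : ℝ) 1))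
    (h : ∀ φ, IsTest φ → ∫ x in Ioo (0 : ℝ) 1, f x * φ x = ∫ x in Ioo (0 : ℝ) 1, f' x * φ x) :
    f =ᵐ[volume.restrict (Ioo (0 : ℝ) 1)] f' := by
  refine (sub_ae_eq_zero _ _).1 (ae_eq_zero_of_forall_integral_mul_test (hf.sub hf') fun φ hφ => ?_)
  simp only [Pi.sub_apply, sub_mul]
  rw [integral_sub (hφ.integrableOn_mul hf) (hφ.integrableOn_mul hf'), h φ hφ, sub_self]

theorem HasWeakDeriv.ae_eq (h : HasWeakDeriv w g) (h' : HasWeakDeriv w g') :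
    g =ᵐ[volume.restrict (Ioo (0 : ℝ) 1)] g' :=
  ae_eq_of_forall_integral_mul_test h.2.1 h'.2.1 fun φ hφ =>
    neg_injective ((h.2.2 φ hφ).symm.trans (h'.2.2 φ hφ))

theorem HasWeakDeriv.weakDeriv_ae_eq (h : HasWeakDeriv w g) :
    weakDeriv w =ᵐ[volume.restrict (Ioo (0 : ℝ) 1)] g := by
  have hex : ∃ g, HasWeakDeriv w g := ⟨g, h⟩
  rw [weakDeriv, dif_pos hex]
  exact hex.choose_spec.ae_eq h

theorem continuous_integral_mul {α : Type*} [MeasurableSpace α] {μ : Measure α} {k : α → ℝ}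
    (hk : MemLp k 2 μ) : Continuous fun f : Lp ℝ 2 μ => ∫ x, f x * k x ∂μ := by
  simp only [← inner_eq_integral_mul_of_ae (ae_eq_refl _) hk.coeFn_toLp]
  fun_prop

theorem hasWeakDeriv_fn (v : H0 1) : HasWeakDeriv v.fn (derivOp 0 1 v.1) := by
  have hfn : MemLp v.fn 2 volume := Lp.memLp v.1.fst
  refine ⟨(hfn.locallyIntegrable (by norm_num)).locallyIntegrableOn _,
    (L2Unit.integrableOn _).locallyIntegrableOn, fun φ hφ => ?_⟩
  have hextend (v : H0 1) :
      ∫ x in Ioo (0 : ℝ) 1, v.fn x * deriv φ x = ∫ x, v.1.fst x * deriv φ x :=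
    setIntegral_eq_integral_of_forall_compl_eq_zero fun x hx => by
      rw [hφ.deriv.eq_zero hx, mul_zero]
  refine H0.induction (P := fun v => ∫ x in Ioo (0 : ℝ) 1, v.fn x * deriv φ x
    = -∫ x in Ioo (0 : ℝ) 1, derivOp 0 1 v.1 x * φ x) ?_ (fun v ψ h => ?_) v
  · simp only [hextend]
    exact isClosed_eq ((continuous_integral_mul (hφ.deriv.memLp 2)).comp H0.continuous_fst)
      ((continuous_integral_mul ((hφ.memLp 2).restrict _)).comp (H0.continuous_derivOp 0 1)).neg
  · exact (h.test.hasWeakDeriv.congr_ae (ae_restrict_of_ae h.fst.symm)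
      (coeFn_derivOp_zero abs_one h).symm).2.2 φ hφ

theorem memH1_fn (v : H0 1) : MemH1 v.fn :=
  ⟨(Lp.memLp v.1.fst).restrict _, _, hasWeakDeriv_fn v, Lp.memLp _⟩

theorem weakDeriv_fn_ae_eq (v : H0 1) :
    weakDeriv v.fn =ᵐ[volume.restrict (Ioo (0 : ℝ) 1)] derivOp 0 1 v.1 :=
  (hasWeakDeriv_fn v).weakDeriv_ae_eq

theorem IsTest.exists_support_subset_Icc (h : IsTest φ) :
    ∃ a b : ℝ, 0 < a ∧ b < 1 ∧ Function.support φ ⊆ Icc a b := by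
  rcases (tsupport φ).eq_empty_or_nonempty with hempty | hne
  · refine ⟨1 / 2, 1 / 2, by norm_num, by norm_num, ?_⟩
    exact (subset_tsupport φ).trans (hempty.trans_subset (empty_subset _))
  · have hc : IsCompact (tsupport φ) := h.compact
    exact ⟨_, _, (h.supp (hc.sInf_mem hne)).1, (h.supp (hc.sSup_mem hne)).2,
      fun x hx => ⟨csInf_le hc.bddBelow (subset_tsupport φ hx),
        le_csSup hc.bddAbove (subset_tsupport φ hx)⟩⟩

theorem support_primitive_subset {a b : ℝ} (ha : 0 < a) (hb : b < 1) (hψ : Continuous ψ)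
    (hsupp : Function.support ψ ⊆ Icc a b) (hzero : ∫ x in (0 : ℝ)..1, ψ x = 0) :
    Function.support (fun x => ∫ t in (0 : ℝ)..x, ψ t) ⊆ Icc a b := by
  have hvanish {y z : ℝ} (h : ∀ t ∈ uIoc y z, t ∉ Icc a b) : ∫ t in y..z, ψ t = 0 :=
    intervalIntegral.integral_zero_ae (Eventually.of_forall fun t ht =>
      Function.notMem_support.1 fun hmem => h t ht (hsupp hmem))
  intro x hx
  by_contra hxab
  refine hx ?_
  rcases lt_or_ge x a with hxa | hax
  · refine hvanish fun t ht hmem => ?_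
    linarith [ht.2, hmem.1, max_lt ha hxa]
  · have hbx : b < x := not_le.1 fun hxb => hxab ⟨hax, hxb⟩
    have htail : ∫ t in (1 : ℝ)..x, ψ t = 0 := by
      refine hvanish fun t ht hmem => ?_
      linarith [ht.1, hmem.2, lt_min hb hbx]
    have hsplit := intervalIntegral.integral_add_adjacent_intervals
      (hψ.intervalIntegrable (μ := volume) 0 1) (hψ.intervalIntegrable 1 x)
    exact hsplit.symm.trans (by rw [hzero, htail, add_zero])

theorem IsTest.exists_deriv_eq (h : IsTest ψ) (hzero : ∫ x in (0 : ℝ)..1, ψ x = 0) :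
    ∃ φ, IsTest φ ∧ _root_.deriv φ = ψ := by
  obtain ⟨a, b, ha, hb, hab⟩ := h.exists_support_subset_Icc
  set φ : ℝ → ℝ := fun x => ∫ t in (0 : ℝ)..x, ψ t
  have hderiv (x : ℝ) : HasDerivAt φ (ψ x) x :=
    (h.continuous.integral_hasStrictDerivAt 0 x).hasDerivAt
  have hderiv_eq : _root_.deriv φ = ψ := funext fun x => (hderiv x).deriv
  have hsupp : Function.support φ ⊆ Icc a b :=
    support_primitive_subset ha hb h.continuous hab hzero
  refine ⟨φ, ⟨?_, HasCompactSupport.of_support_subset_isCompact isCompact_Icc hsupp, ?_⟩,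
    hderiv_eq⟩
  · rw [contDiff_infty_iff_deriv, hderiv_eq]
    exact ⟨fun x => (hderiv x).differentiableAt, h.smooth⟩
  · exact (closure_minimal hsupp isClosed_Icc).trans (Icc_subset_Ioo ha hb)

theorem exists_isTest_integral_eq_one : ∃ ρ, IsTest ρ ∧ ∫ x in (0 : ℝ)..1, ρ x = 1 := by
  let f : ContDiffBump (1 / 2 : ℝ) := ⟨1 / 8, 1 / 4, by norm_num, by norm_num⟩
  have hf : IsTest f := by
    refine ⟨f.contDiff, f.hasCompactSupport, ?_⟩
    rw [f.tsupport_eq, Real.closedBall_eq_Icc]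
    exact Icc_subset_Ioo (by norm_num [f]) (by norm_num [f])
  have hpos : 0 < ∫ x in (0 : ℝ)..1, f x := by
    rw [← setIntegral_Ioo_unit_eq,
      setIntegral_eq_integral_of_forall_compl_eq_zero fun x hx => hf.eq_zero hx]
    exact f.integral_pos
  refine ⟨_, hf.smul (∫ x in (0 : ℝ)..1, f x)⁻¹, ?_⟩
  simp only [Pi.smul_apply, smul_eq_mul]
  rw [intervalIntegral.integral_const_mul, inv_mul_cancel₀ hpos.ne']

theorem IsTest.exists_deriv_eq_sub_integral_smul {ρ : ℝ → ℝ} (hψ : IsTest ψ) (hρ : IsTest ρ)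
    (hone : ∫ x in (0 : ℝ)..1, ρ x = 1) :
    ∃ φ, IsTest φ ∧ ∀ x, _root_.deriv φ x = ψ x - (∫ y in (0 : ℝ)..1, ψ y) * ρ x := by
  set m := ∫ y in (0 : ℝ)..1, ψ y with hm
  have hdiff : (ψ + (-m) • ρ) = fun x => ψ x - m * ρ x := by
    ext x
    simp only [Pi.add_apply, Pi.smul_apply, smul_eq_mul]
    ring
  have htest := hψ.add (hρ.smul (-m))
  rw [hdiff] at htest
  obtain ⟨φ, hφ, hderiv⟩ := htest.exists_deriv_eq (by
    rw [intervalIntegral.integral_sub (hψ.continuous.intervalIntegrable _ _)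
      ((hρ.continuous.intervalIntegrable _ _).const_mul m),
      intervalIntegral.integral_const_mul, hone, ← hm, mul_one, sub_self])
  exact ⟨φ, hφ, congrFun hderiv⟩

theorem exists_ae_eq_const_of_forall_integral_mul_deriv {f : ℝ → ℝ}
    (hf : IntegrableOn f (Ioo 0 1))
    (h : ∀ φ, IsTest φ → ∫ x in Ioo (0 : ℝ) 1, f x * deriv φ x = 0) :
    ∃ c : ℝ, f =ᵐ[volume.restrict (Ioo (0 : ℝ) 1)] fun _ => c := by
  obtain ⟨ρ, hρ, hone⟩ := exists_isTest_integral_eq_one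
  have hloc := hf.locallyIntegrableOn
  refine ⟨∫ x in Ioo (0 : ℝ) 1, f x * ρ x, ae_eq_of_forall_integral_mul_test hloc
    ((locallyIntegrable_const _).locallyIntegrableOn _) fun ψ hψ => ?_⟩
  obtain ⟨φ, hφ, hderiv⟩ := hψ.exists_deriv_eq_sub_integral_smul hρ hone
  have hφ0 := h φ hφ
  simp only [hderiv, mul_sub, mul_left_comm (f _)] at hφ0
  rw [integral_sub (hψ.integrableOn_mul hloc) ((hρ.integrableOn_mul hloc).const_mul _),
    integral_const_mul, sub_eq_zero] at hφ0
  rw [hφ0, integral_const_mul, setIntegral_Ioo_unit_eq ψ, mul_comm]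

end WeakDerivative

section Operators

variable {β θ : ℝ}

/-- The derivative `D I^β_θ` of the two-sided fractional integral, as a bounded operator from
`H^{1-β}_0(0,1)` to `L²(0,1)`. -/
noncomputable def twoSidedOp (β θ : ℝ) : H0 (1 - β) →L[ℝ] L2Unit :=
  (θ • derivOp β 1 + (1 - θ) • derivOp β (-1)) ∘L (testSpace (1 - β)).topologicalClosure.subtypeL

/-- The weak derivative, as a bounded operator from `H^1_0(0,1)` to `L²(0,1)`. -/
noncomputable def gradOp : H0 1 →L[ℝ] L2Unit :=
  derivOp 0 1 ∘L (testSpace 1).topologicalClosure.subtypeL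

theorem twoSidedOp_apply (β θ : ℝ) (u : H0 (1 - β)) :
    twoSidedOp β θ u = θ • derivOp β 1 u.1 + (1 - θ) • derivOp β (-1) u.1 := rfl

theorem gradOp_apply (v : H0 1) : gradOp v = derivOp 0 1 v.1 := rfl

theorem coeFn_twoSidedOp (u : H0 (1 - β)) :
    twoSidedOp β θ u =ᵐ[volume.restrict (Ioo (0 : ℝ) 1)]
      fun t => θ * derivOp β 1 u.1 t + (1 - θ) * derivOp β (-1) u.1 t := by
  rw [twoSidedOp_apply]
  filter_upwards [Lp.coeFn_add (θ • derivOp β 1 u.1) ((1 - θ) • derivOp β (-1) u.1),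
    Lp.coeFn_smul θ (derivOp β 1 u.1), Lp.coeFn_smul (1 - θ) (derivOp β (-1) u.1)]
    with t hadd hleft hright
  rw [hadd, Pi.add_apply, hleft, hright, Pi.smul_apply, Pi.smul_apply, smul_eq_mul, smul_eq_mul]

theorem twoSidedInt_eq (hβ0 : 0 < β) (hβ1 : β < 1 / 2) (u : H0 (1 - β)) {x : ℝ}
    (hx : x ∈ Icc (0 : ℝ) 1) :
    twoSidedInt β θ u.fn x
      = (1 - θ) * rightInt β u.fn 0 + ∫ t in (0 : ℝ)..x, twoSidedOp β θ u t := by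
  have h0 : (0 : ℝ) ∈ Icc (0 : ℝ) 1 := left_mem_Icc.2 zero_le_one
  have h1 : (1 : ℝ) ∈ Icc (0 : ℝ) 1 := right_mem_Icc.2 zero_le_one
  set left := derivOp β 1 u.1
  set right := derivOp β (-1) u.1
  have hsplit := intervalIntegral.integral_add_adjacent_intervals
    (right.intervalIntegrable h0 hx) (right.intervalIntegrable hx h1)
  rw [intervalIntegral_congr_of_ae_unit le_rfl hx.1 hx.2 (coeFn_twoSidedOp u),
    intervalIntegral.integral_add ((left.intervalIntegrable h0 hx).const_mul θ)
      ((right.intervalIntegrable h0 hx).const_mul (1 - θ)),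
    intervalIntegral.integral_const_mul, intervalIntegral.integral_const_mul, twoSidedInt,
    leftInt_eq_integral_derivOp hβ0 hβ1 u hx, rightInt_eq_integral_derivOp hβ0 hβ1 u hx,
    rightInt_eq_integral_derivOp hβ0 hβ1 u h0, ← hsplit]
  ring

theorem twoSidedInt_ae_eq (hβ0 : 0 < β) (hβ1 : β < 1 / 2) (u : H0 (1 - β)) :
    (fun x => (1 - θ) * rightInt β u.fn 0 + ∫ t in (0 : ℝ)..x, twoSidedOp β θ u t)
      =ᵐ[volume.restrict (Ioo (0 : ℝ) 1)] twoSidedInt β θ u.fn := by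
  filter_upwards [ae_restrict_mem measurableSet_Ioo] with x hx
  exact (twoSidedInt_eq hβ0 hβ1 u (Ioo_subset_Icc_self hx)).symm

theorem memH1_twoSidedInt (hβ0 : 0 < β) (hβ1 : β < 1 / 2) (u : H0 (1 - β)) :
    MemH1 (twoSidedInt β θ u.fn) :=
  (memH1_primitive _ _).congr_ae (twoSidedInt_ae_eq hβ0 hβ1 u)

theorem weakDeriv_twoSidedInt_ae_eq (hβ0 : 0 < β) (hβ1 : β < 1 / 2) (u : H0 (1 - β)) :
    weakDeriv (twoSidedInt β θ u.fn) =ᵐ[volume.restrict (Ioo (0 : ℝ) 1)] twoSidedOp β θ u :=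
  ((hasWeakDeriv_primitive (L2Unit.integrableOn _) _).congr_ae
    (twoSidedInt_ae_eq hβ0 hβ1 u) (ae_eq_refl _)).weakDeriv_ae_eq

theorem norm_sq_gradOp (v : H0 1) : ‖gradOp v‖ ^ 2 = ‖v.1.snd‖ ^ 2 := by
  refine H0.induction (P := fun v : H0 1 => ‖gradOp v‖ ^ 2 = ‖v.1.snd‖ ^ 2)
    (isClosed_eq (by fun_prop) (H0.continuous_snd.norm.pow 2)) (fun v φ h => ?_) v
  have hderiv := coeFn_fourierOp_zero abs_one h
  rw [← real_inner_self_eq_norm_sq, gradOp_apply, h.norm_sq_snd,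
    h.inner_derivOp_derivOp h hderiv hderiv fun x hx => by
      rw [h.test.deriv.eq_zero hx, mul_zero]]
  norm_num

theorem norm_le_gradOp (v : H0 1) : ‖v‖ ≤ 2 * ‖gradOp v‖ := by
  have h := norm_sq_le_snd zero_le_one v
  rw [← norm_sq_gradOp] at h
  refine le_of_sq_le_sq ?_ (by positivity)
  nlinarith [sq_nonneg ‖gradOp v‖]

theorem antilipschitz_gradOp : AntilipschitzWith 2 gradOp :=
  gradOp.antilipschitz_of_bound norm_le_gradOp

/-- The constant function `1` in `L²(0,1)`. -/
noncomputable def oneL2 : L2Unit := Lp.const 2 (volume.restrict (Ioo (0 : ℝ) 1)) (1 : ℝ)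

theorem coeFn_oneL2 : oneL2 =ᵐ[volume.restrict (Ioo (0 : ℝ) 1)] fun _ => (1 : ℝ) :=
  Lp.coeFn_const 2 _ 1

theorem inner_oneL2_gradOp (v : H0 1) : inner ℝ oneL2 (gradOp v) = 0 := by
  refine H0.induction (P := fun v => inner ℝ oneL2 (gradOp v) = 0)
    (isClosed_eq (by fun_prop) continuous_const) (fun v φ h => ?_) v
  rw [gradOp_apply, inner_eq_integral_mul_of_ae coeFn_oneL2 (coeFn_derivOp_zero abs_one h)]
  simp only [one_mul]
  rw [setIntegral_Ioo_unit_eq, h.test.integral_deriv]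

theorem exists_eq_smul_oneL2_of_forall_inner_gradOp {y : L2Unit}
    (h : ∀ v, inner ℝ y (gradOp v) = 0) : ∃ c : ℝ, y = c • oneL2 := by
  obtain ⟨c, hc⟩ := exists_ae_eq_const_of_forall_integral_mul_deriv y.integrableOn fun φ hφ => by
    obtain ⟨v, hv⟩ := exists_repBy zero_le_one hφ
    rw [← inner_eq_integral_mul_of_ae (ae_eq_refl y) (coeFn_derivOp_zero abs_one hv)]
    exact h v
  refine ⟨c, Lp.ext ?_⟩
  filter_upwards [hc, coeFn_oneL2, Lp.coeFn_smul c oneL2] with x hy hone hsmul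
  rw [hy, hsmul, Pi.smul_apply, hone, smul_eq_mul, mul_one]

theorem exists_gradOp_eq {y : L2Unit} (h : inner ℝ oneL2 y = 0) : ∃ v, gradOp v = y := by
  have hclosed : IsClosed (gradOp.range : Set L2Unit) :=
    antilipschitz_gradOp.isClosed_range gradOp.uniformContinuous
  have : CompleteSpace gradOp.range := hclosed.completeSpace_coe
  have hmem : y ∈ gradOp.rangeᗮᗮ := by
    refine (Submodule.mem_orthogonal _ _).2 fun z hz => ?_
    obtain ⟨c, rfl⟩ := exists_eq_smul_oneL2_of_forall_inner_gradOp (y := z) fun v => by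
      rw [real_inner_comm]
      exact hz _ ⟨v, rfl⟩
    rw [inner_smul_left, h, mul_zero]
  rwa [Submodule.orthogonal_orthogonal] at hmem

theorem norm_sq_weightedFourier_le {s t : ℝ} (hs : 0 ≤ s) (hst : s ≤ t) (φ : ℝ → ℝ) (ξ : ℝ) :
    ‖weightedFourier s φ ξ‖ ^ 2
      ≤ ‖𝓕 (fun x : ℝ => (φ x : ℂ)) ξ‖ ^ 2 + ‖weightedFourier t φ ξ‖ ^ 2 := by
  have hpow : (|2 * π * ξ| ^ s) ^ 2 ≤ 1 + (|2 * π * ξ| ^ t) ^ 2 := by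
    have hξ : 0 ≤ |2 * π * ξ| := abs_nonneg _
    rcases le_total |2 * π * ξ| 1 with hle | hge
    · linarith [pow_le_one₀ (n := 2) (by positivity) (Real.rpow_le_one hξ hle hs),
        sq_nonneg (|2 * π * ξ| ^ t)]
    · have := pow_le_pow_left₀ (by positivity) (Real.rpow_le_rpow_of_exponent_le hge hst) 2
      linarith
  simp only [norm_weightedFourier, mul_pow]
  nlinarith [sq_nonneg ‖𝓕 (fun x : ℝ => (φ x : ℂ)) ξ‖]

theorem RepBy.norm_le {s t : ℝ} {p : H0 s} {q : H0 t} {φ : ℝ → ℝ} (hs : 0 ≤ s) (hst : s ≤ t)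
    (hp : RepBy s p.1 φ) (hq : RepBy t q.1 φ) : ‖p‖ ≤ 2 * ‖q‖ := by
  have hsnd : ‖p.1.snd‖ ^ 2 ≤ ‖q.1.fst‖ ^ 2 + ‖q.1.snd‖ ^ 2 := by
    have hF := hq.test.integrable_norm_sq_fourier
    have hW := hq.test.integrable_norm_sq_weightedFourier (hs.trans hst)
    rw [hp.norm_sq_snd, hq.norm_sq_snd, hq.norm_sq_fst, ← hq.test.integral_norm_sq_fourier,
      ← integral_add hF hW]
    exact integral_mono (hq.test.integrable_norm_sq_weightedFourier hs) (hF.add hW)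
      (norm_sq_weightedFourier_le hs hst φ)
  have hfst : ‖p.1.fst‖ ^ 2 = ‖q.1.fst‖ ^ 2 := by rw [hp.norm_sq_fst, hq.norm_sq_fst]
  refine le_of_sq_le_sq ?_ (by positivity)
  nlinarith [p.norm_sq_eq, q.norm_sq_eq, sq_nonneg ‖q.1.fst‖, sq_nonneg ‖q.1.snd‖]

theorem RepBy.inner_twoSidedOp_gradOp (hβ0 : 0 < β) (hβ1 : β ≤ 1) {u : H0 (1 - β)} {v : H0 1}
    {φ : ℝ → ℝ} (hu : RepBy (1 - β) u.1 φ) (hv : RepBy 1 v.1 φ) :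
    inner ℝ (twoSidedOp β θ u) (gradOp v)
      = Real.cos (π * β / 2) * ∫ ξ, ‖weightedFourier (1 - β / 2) φ ξ‖ ^ 2 := by
  have habs : |(-1 : ℝ)| = 1 := by rw [abs_neg, abs_one]
  rw [twoSidedOp_apply, inner_add_left, inner_smul_left, inner_smul_left, gradOp_apply,
    hu.inner_derivOp_derivOp_zero abs_one hβ0 hβ1 hv,
    hu.inner_derivOp_derivOp_zero habs hβ0 hβ1 hv]
  simp only [conj_trivial]
  ring

theorem eq_zero_of_fst_eq_zero {v : H0 1} (h : v.1.fst = 0) : v = 0 := by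
  have hfn : v.fn =ᵐ[volume] 0 := by
    rw [H0.fn, h]
    exact Lp.coeFn_zero ℝ 2 volume
  have hgrad : gradOp v = gradOp 0 := by
    rw [map_zero]
    refine Lp.ext ((((hasWeakDeriv_fn v).congr_ae (ae_restrict_of_ae hfn)
      (ae_eq_refl _)).ae_eq IsTest.zero.hasWeakDeriv).trans ?_)
    rw [deriv_zero]
    exact (Lp.coeFn_zero ℝ 2 _).symm
  exact antilipschitz_gradOp.injective hgrad

theorem eq_zero_of_forall_inner_twoSidedOp (hβ0 : 0 < β) (hβ1 : β < 1) {v : H0 1}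
    (h : ∀ u, inner ℝ (twoSidedOp β θ u) (gradOp v) = 0) : v = 0 := by
  set c := Real.cos (π * β / 2)
  have hc : 0 < c := by
    refine Real.cos_pos_of_mem_Ioo ⟨?_, ?_⟩ <;> nlinarith [Real.pi_pos]
  -- `v` is no test function for `h`: it is not known to lie in `H^{1-β}_0(0,1)`. The bound below
  -- is proved for smooth `w` and passes to the limit `w → v`, where its right side vanishes.
  have hbound (w : H0 1) : c * ‖w.1.fst‖ ^ 2
      ≤ 2 * (‖twoSidedOp β θ‖ * (2 * ‖w‖) * ‖gradOp (w - v)‖) := by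
    refine H0.induction (P := fun w => c * ‖w.1.fst‖ ^ 2
      ≤ 2 * (‖twoSidedOp β θ‖ * (2 * ‖w‖) * ‖gradOp (w - v)‖))
      (isClosed_le ((H0.continuous_fst.norm.pow 2).const_mul c) (by fun_prop))
      (fun w φ hw => ?_) w
    obtain ⟨u, hu⟩ := exists_repBy (s := 1 - β) (by linarith) hw.test
    have hinner : inner ℝ (twoSidedOp β θ u) (gradOp (w - v))
        = c * ∫ ξ, ‖weightedFourier (1 - β / 2) φ ξ‖ ^ 2 := by
      rw [map_sub, inner_sub_right, h, sub_zero, hu.inner_twoSidedOp_gradOp hβ0 hβ1.le hw]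
    calc c * ‖w.1.fst‖ ^ 2
        ≤ c * (2 * ∫ ξ, ‖weightedFourier (1 - β / 2) φ ξ‖ ^ 2) := by
          rw [hw.norm_sq_fst]
          exact mul_le_mul_of_nonneg_left (hw.test.integral_sq_le (by linarith)) hc.le
      _ = 2 * inner ℝ (twoSidedOp β θ u) (gradOp (w - v)) := by rw [hinner]; ring
      _ ≤ 2 * (‖twoSidedOp β θ‖ * ‖u‖ * ‖gradOp (w - v)‖) := by
          gcongr
          exact (real_inner_le_norm _ _).trans (by gcongr; exact (twoSidedOp β θ).le_opNorm u)
      _ ≤ 2 * (‖twoSidedOp β θ‖ * (2 * ‖w‖) * ‖gradOp (w - v)‖) := by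
          gcongr
          exact hu.norm_le (by linarith) (by linarith) hw
  have hv := hbound v
  rw [sub_self, map_zero, norm_zero, mul_zero, mul_zero] at hv
  have hfst : ‖v.1.fst‖ ^ 2 = 0 := le_antisymm (nonpos_of_mul_nonpos_right hv hc) (sq_nonneg _)
  exact eq_zero_of_fst_eq_zero (norm_eq_zero.1 (pow_eq_zero_iff two_ne_zero |>.1 hfst))

end Operators

section BetaKernel

theorem intervalIntegrable_rpow_mul_one_sub_rpow {p q : ℝ} (hp : 0 < p) (hq : 0 < q) :
    IntervalIntegrable (fun t : ℝ => t ^ (p - 1) * (1 - t) ^ (q - 1)) volume 0 1 := by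
  have h := (Complex.betaIntegral_convergent (u := p) (v := q) (by simpa) (by simpa)).norm
  rw [intervalIntegrable_unit_iff] at h ⊢
  refine h.congr_fun (fun t ht => ?_) measurableSet_Ioo
  have hp' : (p : ℂ) - 1 = ((p - 1 : ℝ) : ℂ) := by push_cast; rfl
  have hq' : (q : ℂ) - 1 = ((q - 1 : ℝ) : ℂ) := by push_cast; rfl
  have ht' : 1 - (t : ℂ) = ((1 - t : ℝ) : ℂ) := by push_cast; rfl
  simp only
  rw [norm_mul, hp', hq', ht', Complex.norm_cpow_real, Complex.norm_cpow_real, Complex.norm_real,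
    Complex.norm_real, Real.norm_of_nonneg ht.1.le, Real.norm_of_nonneg (sub_pos.2 ht.2).le]

theorem sub_rpow_mul_sub_rpow_eq (p q : ℝ) {a b x : ℝ} (hx : x ∈ Ioo a b) :
    (x - a) ^ (p - 1) * (b - x) ^ (q - 1) = (b - a) ^ (p + q - 2) *
      (((x - a) / (b - a)) ^ (p - 1) * (1 - (x - a) / (b - a)) ^ (q - 1)) := by
  have hab : 0 < b - a := sub_pos.2 (hx.1.trans hx.2)
  have hcompl : 1 - (x - a) / (b - a) = (b - x) / (b - a) := by field_simp; ring
  have hpow : (b - a) ^ (p + q - 2) = (b - a) ^ (p - 1) * (b - a) ^ (q - 1) := by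
    rw [← Real.rpow_add hab]
    ring_nf
  have hp := (Real.rpow_pos_of_pos hab (p - 1)).ne'
  have hq := (Real.rpow_pos_of_pos hab (q - 1)).ne'
  rw [hcompl, hpow, Real.div_rpow (sub_pos.2 hx.1).le hab.le,
    Real.div_rpow (sub_pos.2 hx.2).le hab.le]
  field_simp

theorem integrableOn_sub_rpow_mul_sub_rpow {p q a b : ℝ} (hp : 0 < p) (hq : 0 < q) (hab : a < b) :
    IntegrableOn (fun x => (x - a) ^ (p - 1) * (b - x) ^ (q - 1)) (Ioo a b) := by
  have h := (((intervalIntegrable_rpow_mul_one_sub_rpow hp hq).comp_mul_left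
    (c := (b - a)⁻¹)).comp_sub_right a).const_mul ((b - a) ^ (p + q - 2))
  have hright : 1 / (b - a)⁻¹ + a = b := by rw [one_div, inv_inv, sub_add_cancel]
  rw [zero_div, zero_add, hright, intervalIntegrable_iff_integrableOn_Ioo_of_le hab.le] at h
  refine h.congr_fun (fun x hx => ?_) measurableSet_Ioo
  rw [sub_rpow_mul_sub_rpow_eq p q hx, div_eq_inv_mul]

theorem setIntegral_sub_rpow_mul_sub_rpow (p q : ℝ) {a b : ℝ} (hab : a < b) :
    ∫ x in Ioo a b, (x - a) ^ (p - 1) * (b - x) ^ (q - 1)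
      = (b - a) ^ (p + q - 1) * ∫ t in (0 : ℝ)..1, t ^ (p - 1) * (1 - t) ^ (q - 1) := by
  have hba : 0 < b - a := sub_pos.2 hab
  have hpow : (b - a) ^ (p + q - 1) = (b - a) ^ (p + q - 2) * (b - a) := by
    rw [← Real.rpow_add_one hba.ne']
    ring_nf
  have hsubst := intervalIntegral.integral_comp_div_sub (a := a) (b := b)
    (fun t : ℝ => t ^ (p - 1) * (1 - t) ^ (q - 1)) hba.ne' (a / (b - a))
  simp only [← sub_div, sub_self, div_self hba.ne', smul_eq_mul] at hsubst
  rw [setIntegral_congr_fun measurableSet_Ioo fun x hx => sub_rpow_mul_sub_rpow_eq p q hx,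
    integral_const_mul, ← integral_Ioc_eq_integral_Ioo,
    ← intervalIntegral.integral_of_le hab.le, hsubst, hpow, mul_assoc]

theorem integral_integral_kernel_mul {X Y : Type*} [MeasurableSpace X] [MeasurableSpace Y]
    {μ : Measure X} {ν : Measure Y} [SFinite μ] [SFinite ν] {k : X → Y → ℝ} {f : Y → ℝ} {B : ℝ}
    (hk : Measurable (Function.uncurry k)) (hnonneg : ∀ x y, 0 ≤ k x y)
    (hint : ∀ᵐ y ∂ν, Integrable (fun x => k x y) μ) (hB : ∀ᵐ y ∂ν, ∫ x, k x y ∂μ = B)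
    (hf : Integrable f ν) : ∫ x, ∫ y, k x y * f y ∂ν ∂μ = B * ∫ y, f y ∂ν := by
  have hmeas : AEStronglyMeasurable (Function.uncurry fun x y => k x y * f y) (μ.prod ν) :=
    hk.aestronglyMeasurable.mul hf.aestronglyMeasurable.comp_snd
  have hnorm : (fun y => B * ‖f y‖) =ᵐ[ν] fun y => ∫ x, ‖k x y * f y‖ ∂μ := by
    filter_upwards [hB] with y hy
    simp only [norm_mul, Real.norm_of_nonneg (hnonneg _ _)]
    rw [integral_mul_const, hy]
  have hprod : Integrable (Function.uncurry fun x y => k x y * f y) (μ.prod ν) :=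
    (integrable_prod_iff' hmeas).2
      ⟨hint.mono fun y hy => hy.mul_const (f y), (hf.norm.const_mul B).congr hnorm⟩
  rw [integral_integral_swap hprod, ← integral_const_mul]
  refine integral_congr_ae ?_
  filter_upwards [hB] with y hy
  rw [integral_mul_const, hy]

/-- The kernel `(x - s)^{β-1} (1 - x)^{-β}`, `s < x < 1`, of the composition of `I^{1-β}` with
`I^β`, extended by zero. -/
noncomputable def abelKernel (β x s : ℝ) : ℝ :=
  (Ioo s 1).indicator (fun x => (x - s) ^ (β - 1) * (1 - x) ^ (-β)) x

theorem abelKernel_nonneg (β x s : ℝ) : 0 ≤ abelKernel β x s :=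
  indicator_nonneg (fun _ hx => mul_nonneg (Real.rpow_nonneg (sub_pos.2 hx.1).le _)
    (Real.rpow_nonneg (sub_pos.2 hx.2).le _)) x

theorem measurable_abelKernel (β : ℝ) : Measurable (Function.uncurry (abelKernel β)) := by
  have h : Function.uncurry (abelKernel β) = {p : ℝ × ℝ | p.2 < p.1 ∧ p.1 < 1}.indicator
      fun p => (p.1 - p.2) ^ (β - 1) * (1 - p.1) ^ (-β) := rfl
  rw [h]
  exact Measurable.indicator (by fun_prop) ((measurableSet_lt measurable_snd measurable_fst).inter
    (measurableSet_lt measurable_fst measurable_const))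

variable {β : ℝ}

theorem integrable_abelKernel (hβ0 : 0 < β) (hβ1 : β < 1) {s : ℝ} (hs : s < 1) (t : Set ℝ) :
    IntegrableOn (fun x => abelKernel β x s) t := by
  have h := integrableOn_sub_rpow_mul_sub_rpow hβ0 (sub_pos.2 hβ1) hs
  rw [show 1 - β - 1 = -β by ring] at h
  exact (h.integrable_indicator measurableSet_Ioo).integrableOn

/-- The value is `Γ(β) Γ(1-β)`; only its independence of `s` matters. -/
theorem setIntegral_abelKernel {s : ℝ} (hs : s ∈ Ioo (0 : ℝ) 1) :
    ∫ x in Ioo 0 1, abelKernel β x s = ∫ t in (0 : ℝ)..1, t ^ (β - 1) * (1 - t) ^ (-β) := by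
  have h := setIntegral_sub_rpow_mul_sub_rpow β (1 - β) hs.2
  rw [add_sub_cancel, sub_self, Real.rpow_zero, one_mul, show 1 - β - 1 = -β by ring] at h
  rw [← h]
  unfold abelKernel
  rw [setIntegral_indicator measurableSet_Ioo,
    inter_eq_self_of_subset_right (Ioo_subset_Ioo_left hs.1.le)]

theorem leftInt_mul_rpow_eq (β : ℝ) (w : ℝ → ℝ) {x : ℝ} (hx : x < 1) :
    leftInt β w x * (1 - x) ^ (-β)
      = 1 / Real.Gamma β * ∫ s in Ioo 0 1, abelKernel β x s * w s := by
  have hset : (fun s => abelKernel β x s * w s)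
      = (Iio x).indicator fun s => w s / (x - s) ^ (1 - β) * (1 - x) ^ (-β) := by
    ext s
    by_cases hs : s < x
    · rw [abelKernel, indicator_of_mem (show x ∈ Ioo s 1 from ⟨hs, hx⟩),
        indicator_of_mem (show s ∈ Iio x from hs), ← neg_sub 1 β,
        Real.rpow_neg (sub_pos.2 hs).le, div_eq_mul_inv]
      ring
    · rw [abelKernel, indicator_of_notMem fun h => hs h.1,
        indicator_of_notMem (show s ∉ Iio x from hs), zero_mul]
  have hinter : Ioo 0 1 ∩ Iio x = Ioo 0 x := by
    rw [Ioo_inter_Iio, min_eq_right hx.le]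
  rw [hset, setIntegral_indicator measurableSet_Iio, hinter, integral_mul_const, leftInt, mul_assoc]

theorem setIntegral_leftInt_mul_rpow (hβ0 : 0 < β) (hβ1 : β < 1) {w : ℝ → ℝ}
    (hw : IntegrableOn w (Ioo 0 1)) :
    ∫ x in Ioo 0 1, leftInt β w x * (1 - x) ^ (-β)
      = 1 / Real.Gamma β * ((∫ t in (0 : ℝ)..1, t ^ (β - 1) * (1 - t) ^ (-β)) *
        ∫ s in Ioo 0 1, w s) := by
  rw [setIntegral_congr_fun measurableSet_Ioo fun x hx => leftInt_mul_rpow_eq β w hx.2,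
    integral_const_mul, integral_integral_kernel_mul (measurable_abelKernel β) (abelKernel_nonneg β)
      ?_ ?_ hw]
  all_goals filter_upwards [ae_restrict_mem measurableSet_Ioo] with s hs
  · exact integrable_abelKernel hβ0 hβ1 hs.2 _
  · exact setIntegral_abelKernel hs

theorem memLp_two_one_sub_rpow (hβ : β < 1 / 2) :
    MemLp (fun x : ℝ => (1 - x) ^ (-β)) 2 (volume.restrict (Ioo 0 1)) := by
  rw [memLp_two_iff_integrable_sq (Measurable.aestronglyMeasurable (by fun_prop))]
  have h := integrableOn_sub_rpow_mul_sub_rpow (q := 1 - 2 * β) zero_lt_one (by linarith)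
    (zero_lt_one (α := ℝ))
  refine h.congr_fun (fun x hx => ?_) measurableSet_Ioo
  simp only
  rw [sub_self, Real.rpow_zero, one_mul, ← Real.rpow_mul_natCast (sub_pos.2 hx.2).le]
  push_cast
  ring_nf

instance neBot_ae_unit : (ae (volume.restrict (Ioo (0 : ℝ) 1))).NeBot := by
  rw [ae_neBot, Ne, Measure.restrict_eq_zero, Real.volume_Ioo]
  norm_num

theorem exists_ne_zero_forall_inner_derivOp_eq_zero (hβ0 : 0 < β) (hβ1 : β < 1 / 2) :
    ∃ g : L2Unit, g ≠ 0 ∧ ∀ u : H0 (1 - β), inner ℝ (derivOp β 1 u.1) g = 0 := by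
  have hg := memLp_two_one_sub_rpow hβ1
  refine ⟨hg.toLp, fun h0 => ?_, fun u => ?_⟩
  · have hzero := Lp.coeFn_zero ℝ 2 (volume.restrict (Ioo (0 : ℝ) 1))
    rw [← h0] at hzero
    obtain ⟨x, ⟨hz, hx⟩, hmem⟩ :=
      ((hzero.and hg.coeFn_toLp).and (ae_restrict_mem measurableSet_Ioo)).exists
    exact (Real.rpow_pos_of_pos (sub_pos.2 hmem.2) _).ne' (hx ▸ hz)
  · refine H0.induction (P := fun u => inner ℝ (derivOp β 1 u.1) hg.toLp = 0)
      (isClosed_eq (((H0.continuous_derivOp β 1).inner continuous_const)) continuous_const)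
      (fun u φ h => ?_) u
    have hderiv := h.test.deriv
    rw [inner_eq_integral_mul_of_ae (coeFn_derivOp abs_one hβ0 (by linarith) h) hg.coeFn_toLp]
    simp only [← leftInt_eq_fracInt hderiv]
    rw [setIntegral_leftInt_mul_rpow hβ0 (by linarith)
        (hderiv.continuous.integrableOn_Icc.mono_set Ioo_subset_Icc_self),
      setIntegral_Ioo_unit_eq, h.test.integral_deriv, mul_zero, mul_zero]

end BetaKernel

theorem exists_antilipschitz_twoSidedOp {β : ℝ} (hβ0 : 0 < β) (hβ1 : β < 1 / 2) :
    ∃ C, ∀ θ ∈ Icc (0 : ℝ) 1, AntilipschitzWith C (twoSidedOp β θ) := by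
  set c := Real.cos (π * β)
  have hc : 0 < c := by
    refine Real.cos_pos_of_mem_Ioo ⟨?_, ?_⟩ <;> nlinarith [Real.pi_pos]
  set Z := derivOp β 1 + derivOp β (-1)
  refine ⟨(3 * ‖Z‖ / c).toNNReal, fun θ hθ =>
    (twoSidedOp β θ).antilipschitz_of_bound fun u => ?_⟩
  rw [Real.coe_toNNReal _ (by positivity)]
  set left := derivOp β 1 u.1
  set right := derivOp β (-1) u.1
  have hinner : inner ℝ (twoSidedOp β θ u) (Z u.1)
      = θ * ‖left‖ ^ 2 + (1 - θ) * ‖right‖ ^ 2 + inner ℝ left right := by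
    rw [twoSidedOp_apply, show Z u.1 = left + right from rfl, inner_add_left, inner_smul_left,
      inner_smul_left, inner_add_right, inner_add_right, real_inner_self_eq_norm_sq,
      real_inner_self_eq_norm_sq, real_inner_comm left right]
    simp only [conj_trivial]
    ring
  have hlower : c * ‖u.1.snd‖ ^ 2 ≤ inner ℝ (twoSidedOp β θ u) (Z u.1) := by
    rw [hinner, inner_derivOp_one_neg_one hβ0 (by linarith)]
    have := mul_nonneg hθ.1 (sq_nonneg ‖left‖)
    have := mul_nonneg (sub_nonneg.2 hθ.2) (sq_nonneg ‖right‖)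
    linarith
  have hupper : inner ℝ (twoSidedOp β θ u) (Z u.1) ≤ ‖twoSidedOp β θ u‖ * (‖Z‖ * ‖u‖) :=
    (real_inner_le_norm _ _).trans (by gcongr; exact Z.le_opNorm u.1)
  rcases (norm_nonneg u).eq_or_lt with h0 | hpos
  · rw [← h0]
    positivity
  · rw [div_mul_eq_mul_div, le_div_iff₀ hc]
    refine le_of_mul_le_mul_right ?_ hpos
    nlinarith [norm_sq_le_snd (by linarith : 0 ≤ 1 - β) u]

section MethodOfContinuity

open scoped NNReal

variable {𝕜 E F : Type*} [NontriviallyNormedField 𝕜] [NormedAddCommGroup E] [NormedSpace 𝕜 E]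
  [CompleteSpace E] [NormedAddCommGroup F] [NormedSpace 𝕜 F] [CompleteSpace F] {C : ℝ≥0}

theorem exists_equiv_apply_eq_of_bijective {T : E →L[𝕜] F} (hT : Function.Bijective T) :
    ∃ e : E ≃L[𝕜] F, ∀ u, e u = T u :=
  ⟨.ofBijective T (LinearMap.ker_eq_bot.2 hT.injective) (LinearMap.range_eq_top.2 hT.surjective),
    fun _ => rfl⟩

theorem surjective_of_norm_sub_lt_one {T T' : E →L[𝕜] F} (hanti : AntilipschitzWith C T)
    (hT : Function.Surjective T) (hlt : C * ‖T - T'‖ < 1) : Function.Surjective T' := by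
  obtain ⟨e, he⟩ := exists_equiv_apply_eq_of_bijective ⟨hanti.injective, hT⟩
  set R : E →L[𝕜] E := (e.symm : F →L[𝕜] E) ∘L (T - T')
  have hR : ‖R‖ < 1 := by
    refine (R.opNorm_le_bound (by positivity) fun u => ?_).trans_lt hlt
    calc ‖R u‖ ≤ C * ‖T (R u)‖ := hanti.le_mul_norm (map_zero T) (R u)
      _ = C * ‖(T - T') u‖ := by rw [← he]; exact congrArg (C * ‖·‖) (e.apply_symm_apply _)
      _ ≤ C * (‖T - T'‖ * ‖u‖) := by gcongr; exact (T - T').le_opNorm u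
      _ = C * ‖T - T'‖ * ‖u‖ := (mul_assoc _ _ _).symm
  obtain ⟨S, hS⟩ := isUnit_one_sub_of_norm_lt_one hR
  have hfactor (u : E) : T ((1 - R) u) = T' u := by
    have hTR : T (R u) = T u - T' u := (he _).symm.trans (e.apply_symm_apply _)
    rw [sub_apply, one_apply_eq_self, map_sub, hTR, sub_sub_cancel]
  intro y
  obtain ⟨x, rfl⟩ := hT y
  refine ⟨(↑S⁻¹ : E →L[𝕜] E) x, ?_⟩
  rw [← hfactor, ← hS, ← mul_apply_eq_comp, Units.mul_inv,
    one_apply_eq_self]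

theorem surjective_iff_of_isPreconnected {ι : Type*} [TopologicalSpace ι] {s : Set ι}
    (hs : IsPreconnected s) {T : ι → E →L[𝕜] F} (hT : ContinuousOn T s)
    (hanti : ∀ i ∈ s, AntilipschitzWith C (T i)) {i j : ι} (hi : i ∈ s) (hj : j ∈ s) :
    Function.Surjective (T i) ↔ Function.Surjective (T j) := by
  refine hs.induction₂ (fun i j => Function.Surjective (T i) ↔ Function.Surjective (T j))
    (fun i hi => ?_) (fun _ _ _ _ _ _ => Iff.trans) (fun _ _ _ _ => Iff.symm) hi hj
  have hlim : Tendsto (fun j => C * ‖T i - T j‖) (𝓝[s] i) (𝓝 0) := by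
    have h := ((tendsto_const_nhds (x := T i)).sub (hT i hi)).norm.const_mul (C : ℝ)
    simpa only [sub_self, norm_zero, mul_zero] using h
  filter_upwards [hlim.eventually_lt_const one_pos, self_mem_nhdsWithin] with j hlt hj
  exact ⟨fun h => surjective_of_norm_sub_lt_one (hanti i hi) h hlt,
    fun h => surjective_of_norm_sub_lt_one (hanti j hj) h (by rwa [norm_sub_rev])⟩

end MethodOfContinuity

theorem exists_forall_mem_iff_inner_eq_zero {𝕜 E : Type*} [RCLike 𝕜] [NormedAddCommGroup E]
    [InnerProductSpace 𝕜 E] {V : Submodule 𝕜 E} [V.HasOrthogonalProjection] (hV : V ≠ ⊤) {e : E}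
    (he : ∀ z ∈ Vᗮ, inner 𝕜 e z = 0 → z = 0) : ∃ n, ∀ y, y ∈ V ↔ inner 𝕜 n y = 0 := by
  obtain ⟨n, hn, hn0⟩ := Submodule.exists_mem_ne_zero_of_ne_bot
    (mt Submodule.orthogonal_eq_bot_iff.1 hV)
  have hen : inner 𝕜 e n ≠ 0 := mt (he n hn) hn0
  refine ⟨n, fun y => ⟨fun hy => Submodule.inner_left_of_mem_orthogonal hy hn, fun hy => ?_⟩⟩
  rw [← V.orthogonal_orthogonal, Submodule.mem_orthogonal]
  intro z hz
  have hz' : z - (inner 𝕜 e z / inner 𝕜 e n) • n = 0 := by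
    refine he _ (Vᗮ.sub_mem hz (Vᗮ.smul_mem _ hn)) ?_
    rw [inner_sub_right, inner_smul_right, div_mul_cancel₀ _ hen, sub_self]
  rw [sub_eq_zero.1 hz', inner_smul_left, hy, mul_zero]

section Isomorphism

variable {β θ : ℝ}

theorem continuous_twoSidedOp (β : ℝ) : Continuous (twoSidedOp β) :=
  ((continuous_id.smul continuous_const).add
    ((continuous_const.sub continuous_id).smul continuous_const)).clm_comp continuous_const

theorem not_surjective_twoSidedOp (hβ0 : 0 < β) (hβ1 : β < 1 / 2) (hθ : θ ∈ Icc (0 : ℝ) 1) :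
    ¬ Function.Surjective (twoSidedOp β θ) := by
  obtain ⟨C, hC⟩ := exists_antilipschitz_twoSidedOp hβ0 hβ1
  obtain ⟨g, hg0, hg⟩ := exists_ne_zero_forall_inner_derivOp_eq_zero hβ0 hβ1
  rw [surjective_iff_of_isPreconnected isPreconnected_Icc (continuous_twoSidedOp β).continuousOn hC
    hθ (right_mem_Icc.2 zero_le_one)]
  intro hsurj
  obtain ⟨u, hu⟩ := hsurj g
  rw [twoSidedOp_apply, sub_self, zero_smul, add_zero, one_smul] at hu
  exact hg0 (inner_self_eq_zero.1 (hu ▸ hg u))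

theorem exists_forall_mem_range_twoSidedOp_iff (hβ0 : 0 < β) (hβ1 : β < 1 / 2)
    (hθ : θ ∈ Icc (0 : ℝ) 1) :
    ∃ n : L2Unit, ∀ y, y ∈ (twoSidedOp β θ).range ↔ inner ℝ n y = 0 := by
  obtain ⟨C, hC⟩ := exists_antilipschitz_twoSidedOp hβ0 hβ1
  have : CompleteSpace (twoSidedOp β θ).range :=
    ((hC θ hθ).isClosed_range (twoSidedOp β θ).uniformContinuous).completeSpace_coe
  refine exists_forall_mem_iff_inner_eq_zero (e := oneL2)
    (mt LinearMap.range_eq_top.1 (not_surjective_twoSidedOp hβ0 hβ1 hθ)) fun z hz hone => ?_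
  obtain ⟨v, rfl⟩ := exists_gradOp_eq hone
  have hv : v = 0 := eq_zero_of_forall_inner_twoSidedOp (θ := θ) hβ0 (by linarith)
    fun u => hz _ ⟨u, rfl⟩
  rw [hv, map_zero]

theorem exists_forall_inner_gradOp_eq (f : StrongDual ℝ (H0 1)) :
    ∃ y, ∀ v, inner ℝ y (gradOp v) = f v := by
  set b : H0 1 →L[ℝ] H0 1 →L[ℝ] ℝ := (innerSL ℝ).bilinearComp gradOp gradOp
  have hb (u v : H0 1) : b u v = inner ℝ (gradOp u) (gradOp v) := rfl
  have hcoercive : IsCoercive b := by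
    refine ⟨1 / 4, by norm_num, fun u => ?_⟩
    rw [hb, real_inner_self_eq_norm_sq]
    nlinarith [norm_le_gradOp u, norm_nonneg u]
  refine ⟨gradOp (hcoercive.continuousLinearEquivOfBilin.symm
    ((InnerProductSpace.toDual ℝ (H0 1)).symm f)), fun v => ?_⟩
  rw [← hb, ← hcoercive.continuousLinearEquivOfBilin_apply,
    ContinuousLinearEquiv.apply_symm_apply, InnerProductSpace.toDual_symm_apply]

/-- The operator `u ↦ (k D I^β_θ u, D ·)` of the Petrov–Galerkin form with an arbitrary
isomorphism `k` of `L²(0,1)` as coefficient. -/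
noncomputable def pgOp (β θ : ℝ) (k : L2Unit ≃L[ℝ] L2Unit) :
    H0 (1 - β) →L[ℝ] StrongDual ℝ (H0 1) :=
  (innerSL ℝ).bilinearComp ((k : L2Unit →L[ℝ] L2Unit) ∘L twoSidedOp β θ) gradOp

theorem pgOp_apply (β θ : ℝ) (k : L2Unit ≃L[ℝ] L2Unit) (u : H0 (1 - β)) (v : H0 1) :
    pgOp β θ k u v = inner ℝ (k (twoSidedOp β θ u)) (gradOp v) := rfl

theorem injective_pgOp (hβ0 : 0 < β) (hβ1 : β < 1 / 2) (hθ : θ ∈ Icc (0 : ℝ) 1)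
    {k : L2Unit ≃L[ℝ] L2Unit} (hk : k.symm oneL2 ∉ (twoSidedOp β θ).range) :
    Function.Injective (pgOp β θ k) := by
  refine (injective_iff_map_eq_zero _).2 fun u hu => ?_
  obtain ⟨c, hc⟩ := exists_eq_smul_oneL2_of_forall_inner_gradOp (y := k (twoSidedOp β θ u))
    fun v => by rw [← pgOp_apply, hu, zero_apply]
  have hflux : twoSidedOp β θ u = c • k.symm oneL2 := by
    rw [← map_smul, ← hc, k.symm_apply_apply]
  have hc0 : c = 0 := by
    by_contra hne
    refine hk ⟨c⁻¹ • u, ?_⟩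
    rw [ContinuousLinearMap.coe_coe, map_smul, hflux, inv_smul_smul₀ hne]
  obtain ⟨C, hC⟩ := exists_antilipschitz_twoSidedOp hβ0 hβ1
  exact (hC θ hθ).injective (by rw [hflux, hc0, zero_smul, map_zero])

theorem surjective_pgOp (hβ0 : 0 < β) (hβ1 : β < 1 / 2) (hθ : θ ∈ Icc (0 : ℝ) 1)
    {k : L2Unit ≃L[ℝ] L2Unit} (hk : k.symm oneL2 ∉ (twoSidedOp β θ).range) :
    Function.Surjective (pgOp β θ k) := by
  intro f
  obtain ⟨n, hn⟩ := exists_forall_mem_range_twoSidedOp_iff hβ0 hβ1 hθ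
  obtain ⟨y, hy⟩ := exists_forall_inner_gradOp_eq f
  -- `D v ⟂ 1` lets `y` be shifted by constants until its flux `k⁻¹ y` is in the range.
  obtain ⟨u, hu⟩ := (hn (k.symm y - (inner ℝ n (k.symm y) / inner ℝ n (k.symm oneL2)) •
      k.symm oneL2)).2 <| by
    rw [inner_sub_right, inner_smul_right, div_mul_cancel₀ _ (mt (hn _).2 hk), sub_self]
  rw [ContinuousLinearMap.coe_coe] at hu
  refine ⟨u, ContinuousLinearMap.ext fun v => ?_⟩
  rw [pgOp_apply, hu, map_sub, map_smul, k.apply_symm_apply, k.apply_symm_apply, inner_sub_left,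
    inner_smul_left, inner_oneL2_gradOp, mul_zero, sub_zero, hy]

theorem exists_equiv_eq_pgOp (hβ0 : 0 < β) (hβ1 : β < 1 / 2) (hθ : θ ∈ Icc (0 : ℝ) 1)
    {k : L2Unit ≃L[ℝ] L2Unit} (hk : k.symm oneL2 ∉ (twoSidedOp β θ).range) :
    ∃ S : H0 (1 - β) ≃L[ℝ] StrongDual ℝ (H0 1), ∀ u, S u = pgOp β θ k u := by
  have hbij : Function.Bijective (pgOp β θ k) :=
    ⟨injective_pgOp hβ0 hβ1 hθ hk, surjective_pgOp hβ0 hβ1 hθ hk⟩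
  exact exists_equiv_apply_eq_of_bijective (𝕜 := ℝ) (E := H0 (1 - β)) (F := StrongDual ℝ (H0 1))
    hbij

end Isomorphism

section InfSup

variable {E F : Type*} [NormedAddCommGroup E] [NormedSpace ℝ E] [NormedAddCommGroup F]
  [NormedSpace ℝ F] (S : E ≃L[ℝ] StrongDual ℝ F)

theorem opNorm_le_of_forall_apply_le {f : StrongDual ℝ F} {C : ℝ} (hC : 0 ≤ C)
    (h : ∀ v, f v ≤ C * ‖v‖) : ‖f‖ ≤ C := by
  refine f.opNorm_le_bound hC fun v => abs_le.2 ⟨?_, h v⟩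
  have := h (-v)
  rw [map_neg, norm_neg] at this
  linarith

theorem le_iInf_iSup_div_norm {κ : ℝ} (hκ0 : 0 ≤ κ)
    (hκ : κ * ‖(S.symm : StrongDual ℝ F →L[ℝ] E)‖ < 1) :
    (κ : EReal) ≤ ⨅ w : {w : E // w ≠ 0}, ⨆ v : {v : F // v ≠ 0},
      ((S w.1 v.1 / (‖w.1‖ * ‖v.1‖) : ℝ) : EReal) := by
  refine le_iInf fun ⟨w, hw0⟩ => ?_
  by_contra! hlt
  have hw : 0 < ‖w‖ := norm_pos_iff.2 hw0
  have hform (v : F) : S w v ≤ κ * ‖w‖ * ‖v‖ := by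
    rcases eq_or_ne v 0 with rfl | hv
    · simp
    · have hv' : S w v / (‖w‖ * ‖v‖) < κ := EReal.coe_lt_coe_iff.1 <|
        (le_iSup (fun v : {v : F // v ≠ 0} =>
          ((S w v.1 / (‖w‖ * ‖v.1‖) : ℝ) : EReal)) ⟨v, hv⟩).trans_lt hlt
      rw [div_lt_iff₀ (mul_pos hw (norm_pos_iff.2 hv))] at hv'
      linarith
  have hSw : ‖S w‖ ≤ κ * ‖w‖ := opNorm_le_of_forall_apply_le (by positivity) hform
  have hself : ‖w‖ ≤ κ * ‖(S.symm : StrongDual ℝ F →L[ℝ] E)‖ * ‖w‖ := by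
    calc ‖w‖ = ‖S.symm (S w)‖ := by rw [S.symm_apply_apply]
      _ ≤ ‖(S.symm : StrongDual ℝ F →L[ℝ] E)‖ * ‖S w‖ :=
        (S.symm : StrongDual ℝ F →L[ℝ] E).le_opNorm (S w)
      _ ≤ ‖(S.symm : StrongDual ℝ F →L[ℝ] E)‖ * (κ * ‖w‖) := by gcongr
      _ = κ * ‖(S.symm : StrongDual ℝ F →L[ℝ] E)‖ * ‖w‖ := by ring
  nlinarith

theorem iSup_apply_pos {v : F} (hv : v ≠ 0) : (0 : EReal) < ⨆ w : E, ((S w v : ℝ) : EReal) := by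
  obtain ⟨g, -, hg⟩ := exists_dual_vector ℝ v (norm_ne_zero_iff.2 hv)
  refine lt_of_lt_of_le ?_ (le_iSup (fun w : E => ((S w v : ℝ) : EReal)) (S.symm g))
  rw [S.apply_symm_apply, hg]
  exact EReal.coe_pos.2 (norm_pos_iff.2 hv)

theorem exists_infSup_and_wellPosed : ∃ κ : ℝ, 0 < κ ∧
    (κ : EReal) ≤ (⨅ w : {w : E // w ≠ 0}, ⨆ v : {v : F // v ≠ 0},
      ((S w.1 v.1 / (‖w.1‖ * ‖v.1‖) : ℝ) : EReal)) ∧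
    (∀ v : F, v ≠ 0 → (0 : EReal) < ⨆ w : E, ((S w v : ℝ) : EReal)) ∧
    (∀ f : StrongDual ℝ F, (∃! u : E, ∀ v : F, S u v = f v) ∧
      ∀ u : E, (∀ v : F, S u v = f v) → ‖u‖ ≤ κ⁻¹ * ‖f‖) := by
  set M := ‖(S.symm : StrongDual ℝ F →L[ℝ] E)‖
  have hM : 0 < M + 1 := by positivity
  have hsol {f : StrongDual ℝ F} {u : E} (hu : ∀ v, S u v = f v) : u = S.symm f :=
    S.eq_symm_apply.2 (ContinuousLinearMap.ext hu)
  refine ⟨(M + 1)⁻¹, by positivity, ?_, fun v hv => iSup_apply_pos S hv, fun f => ⟨?_, ?_⟩⟩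
  · refine le_iInf_iSup_div_norm S (by positivity) ?_
    rw [inv_mul_lt_iff₀ hM]
    linarith
  · exact ⟨S.symm f, fun v => by rw [S.apply_symm_apply], fun u hu => hsol hu⟩
  · intro u hu
    rw [inv_inv, hsol hu]
    calc ‖S.symm f‖ ≤ M * ‖f‖ := (S.symm : StrongDual ℝ F →L[ℝ] E).le_opNorm f
      _ ≤ (M + 1) * ‖f‖ := by gcongr; linarith

end InfSup

section MultiplicationEquiv

variable {α 𝕜 : Type*} [RCLike 𝕜] [MeasurableSpace α] {μ : Measure α} {m m' : α → 𝕜}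

theorem mulLp_mulLp_of_mul_ae_eq_one (hm : MemLp m ∞ μ) (hm' : MemLp m' ∞ μ)
    (h : ∀ᵐ x ∂μ, m x * m' x = 1) (f : Lp 𝕜 2 μ) : mulLp hm (mulLp hm' f) = f := by
  refine Lp.ext ?_
  filter_upwards [coeFn_mulLp hm (mulLp hm' f), coeFn_mulLp hm' f, h] with x hx hx' hone
  rw [hx, hx', ← mul_assoc, hone, one_mul]

/-- Multiplication by an essentially bounded function with essentially bounded inverse, as an
automorphism of `L²`. -/
noncomputable def mulLpEquiv (hm : MemLp m ∞ μ) (hm' : MemLp m' ∞ μ)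
    (h : ∀ᵐ x ∂μ, m x * m' x = 1) : Lp 𝕜 2 μ ≃L[𝕜] Lp 𝕜 2 μ :=
  .equivOfInverse (mulLp hm) (mulLp hm')
    (mulLp_mulLp_of_mul_ae_eq_one hm' hm (by simpa only [mul_comm] using h))
    (mulLp_mulLp_of_mul_ae_eq_one hm hm' h)

theorem coeFn_mulLpEquiv (hm : MemLp m ∞ μ) (hm' : MemLp m' ∞ μ)
    (h : ∀ᵐ x ∂μ, m x * m' x = 1) (f : Lp 𝕜 2 μ) :
    mulLpEquiv hm hm' h f =ᵐ[μ] fun x => m x * f x :=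
  coeFn_mulLp hm f

theorem coeFn_mulLpEquiv_symm (hm : MemLp m ∞ μ) (hm' : MemLp m' ∞ μ)
    (h : ∀ᵐ x ∂μ, m x * m' x = 1) (f : Lp 𝕜 2 μ) :
    (mulLpEquiv hm hm' h).symm f =ᵐ[μ] fun x => m' x * f x :=
  coeFn_mulLp hm' f

end MultiplicationEquiv

section Form

variable {K : ℝ → ℝ} {β θ : ℝ} {e : L2Unit}

theorem integral_ne_zero_of_mul_ae_eq_one
    (hK : ∀ᵐ x ∂(volume.restrict (Ioo (0 : ℝ) 1)), 0 < K x)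
    (he : ∀ᵐ x ∂(volume.restrict (Ioo (0 : ℝ) 1)), K x * e x = 1) :
    ∫ t in (0 : ℝ)..1, e t ≠ 0 := by
  have hpos : ∀ᵐ x ∂(volume.restrict (Ioo (0 : ℝ) 1)), 0 < e x := by
    filter_upwards [hK, he] with x hx hone
    exact pos_of_mul_pos_right (one_pos.trans_eq hone.symm) hx.le
  rw [← setIntegral_Ioo_unit_eq, ne_eq,
    integral_eq_zero_iff_of_nonneg_ae (hpos.mono fun _ => le_of_lt) e.integrableOn]
  intro hzero
  obtain ⟨x, hx, hx0⟩ := (hpos.and hzero).exists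
  exact hx.ne' hx0

theorem isLeftHarmonic_of_mul_ae_eq_one
    (he : ∀ᵐ x ∂(volume.restrict (Ioo (0 : ℝ) 1)), K x * e x = 1)
    (hint : ∫ t in (0 : ℝ)..1, e t ≠ 0) :
    IsLeftHarmonic K
      fun x => 1 + ∫ t in (0 : ℝ)..x, (-(∫ t in (0 : ℝ)..1, e t)⁻¹ • e : L2Unit) t := by
  set a := ∫ t in (0 : ℝ)..1, e t with ha
  set g : L2Unit := -a⁻¹ • e
  have hg : g =ᵐ[volume.restrict (Ioo (0 : ℝ) 1)] fun x => -a⁻¹ * e x := Lp.coeFn_smul (-a⁻¹) e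
  refine ⟨memH1_primitive g 1, continuousOn_primitive_unit g.integrableOn 1, ?_, ?_, fun v => ?_⟩
  · rw [intervalIntegral.integral_same, add_zero]
  · rw [intervalIntegral_congr_of_ae_unit le_rfl zero_le_one le_rfl hg,
      intervalIntegral.integral_const_mul, ← ha, neg_mul, inv_mul_cancel₀ hint, add_neg_cancel]
  · have hflux : ∀ᵐ x ∂(volume.restrict (Ioo (0 : ℝ) 1)),
        K x * weakDeriv (fun x => 1 + ∫ t in (0 : ℝ)..x, g t) x * weakDeriv v.fn x
          = -a⁻¹ * (1 * gradOp v x) := by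
      filter_upwards [(hasWeakDeriv_primitive g.integrableOn 1).weakDeriv_ae_eq, hg, he,
        weakDeriv_fn_ae_eq v] with x hw hgx hone hv
      rw [hw, hgx, hv, gradOp_apply]
      linear_combination (-a⁻¹ * derivOp 0 1 v.1 x) * hone
    rw [integral_congr_ae hflux, integral_const_mul,
      ← inner_eq_integral_mul_of_ae coeFn_oneL2 ae_eq_rfl, inner_oneL2_gradOp, mul_zero]

theorem rightInt_one (σ : ℝ) (w : ℝ → ℝ) : rightInt σ w 1 = 0 := by
  rw [rightInt, Ioo_self, setIntegral_empty, mul_zero]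

theorem notMem_range_twoSidedOp (hβ0 : 0 < β) (hβ1 : β < 1 / 2) (hV : Nondegenerate K β θ)
    (he : ∀ᵐ x ∂(volume.restrict (Ioo (0 : ℝ) 1)), K x * e x = 1)
    (hint : ∫ t in (0 : ℝ)..1, e t ≠ 0) : e ∉ (twoSidedOp β θ).range := by
  rintro ⟨u, hu⟩
  rw [ContinuousLinearMap.coe_coe] at hu
  have hw := isLeftHarmonic_of_mul_ae_eq_one he hint
  set a := ∫ t in (0 : ℝ)..1, e t
  set ul : H0 (1 - β) := -a⁻¹ • u with hul
  have hint_ul {x : ℝ} (hx : x ∈ Icc (0 : ℝ) 1) : twoSidedInt β θ ul.fn x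
      = (1 - θ) * rightInt β ul.fn 0 + ∫ t in (0 : ℝ)..x, (-a⁻¹ • e : L2Unit) t := by
    rw [twoSidedInt_eq hβ0 hβ1 ul hx, hul, map_smul, hu]
  have hul_one := hint_ul (right_mem_Icc.2 zero_le_one)
  rw [twoSidedInt, rightInt_one] at hul_one
  have hw_one := hw.at_one
  refine hV _ ul hw (fun x hx => ?_) (by linarith)
  rw [hint_ul hx]
  linear_combination (-x) * hul_one - x * hw_one

theorem pgForm_eq_inner (hβ0 : 0 < β) (hβ1 : β < 1 / 2) {k : L2Unit → L2Unit}
    (hk : ∀ y, k y =ᵐ[volume.restrict (Ioo (0 : ℝ) 1)] fun x => K x * y x)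
    (u : H0 (1 - β)) (v : H0 1) : pgForm K β θ u v = inner ℝ (k (twoSidedOp β θ u)) (gradOp v) := by
  rw [inner_eq_integral_mul_of_ae (hk _) ae_eq_rfl, pgForm]
  refine integral_congr_ae ?_
  filter_upwards [weakDeriv_twoSidedInt_ae_eq hβ0 hβ1 u, weakDeriv_fn_ae_eq v] with x hu hv
  rw [hu, hv, gradOp_apply]

theorem exists_equiv_eq_pgForm (hβ0 : 0 < β) (hβ1 : β < 1 / 2) (hθ : θ ∈ Icc (0 : ℝ) 1)
    (hK : AEMeasurable K (volume.restrict (Ioo (0 : ℝ) 1))) {Km KM : ℝ} (hKm : 0 < Km)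
    (hKb : ∀ᵐ x ∂(volume.restrict (Ioo (0 : ℝ) 1)), Km ≤ K x ∧ K x ≤ KM)
    (hV : Nondegenerate K β θ) :
    ∃ S : H0 (1 - β) ≃L[ℝ] StrongDual ℝ (H0 1), ∀ u v, S u v = pgForm K β θ u v := by
  have hpos : ∀ᵐ x ∂(volume.restrict (Ioo (0 : ℝ) 1)), 0 < K x :=
    hKb.mono fun x hx => hKm.trans_le hx.1
  have hbdd : MemLp K ∞ (volume.restrict (Ioo (0 : ℝ) 1)) := by
    refine memLp_top_of_bound hK.aestronglyMeasurable KM ?_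
    filter_upwards [hKb, hpos] with x hx hx0
    exact (Real.norm_of_nonneg hx0.le).trans_le hx.2
  have hbdd_inv : MemLp K⁻¹ ∞ (volume.restrict (Ioo (0 : ℝ) 1)) := by
    refine memLp_top_of_bound hK.inv.aestronglyMeasurable Km⁻¹ ?_
    filter_upwards [hKb, hpos] with x hx hx0
    rw [Pi.inv_apply, norm_inv, Real.norm_of_nonneg hx0.le]
    exact inv_anti₀ hKm hx.1
  have hinv : ∀ᵐ x ∂(volume.restrict (Ioo (0 : ℝ) 1)), K x * K⁻¹ x = 1 :=
    hpos.mono fun x hx => mul_inv_cancel₀ hx.ne'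
  set k := mulLpEquiv hbdd hbdd_inv hinv
  have hflux : ∀ᵐ x ∂(volume.restrict (Ioo (0 : ℝ) 1)), K x * k.symm oneL2 x = 1 := by
    filter_upwards [coeFn_mulLpEquiv_symm hbdd hbdd_inv hinv oneL2, coeFn_oneL2, hinv]
      with x hx hone hKx
    rw [hx, hone, mul_one, hKx]
  have hk := notMem_range_twoSidedOp hβ0 hβ1 hV hflux (integral_ne_zero_of_mul_ae_eq_one hpos hflux)
  obtain ⟨S, hS⟩ := exists_equiv_eq_pgOp hβ0 hβ1 hθ hk
  refine ⟨S, fun u v => ?_⟩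
  rw [pgForm_eq_inner hβ0 hβ1 (coeFn_mulLpEquiv hbdd hbdd_inv hinv), hS, pgOp_apply]

end Form

theorem theorem6p4 (β θ : ℝ) (hβ0 : 0 < β) (hβ1 : β < 1 / 2) (hθ0 : 0 ≤ θ) (hθ1 : θ ≤ 1)
    (K : ℝ → ℝ) (hK : AEMeasurable K (volume.restrict (Ioo (0 : ℝ) 1)))
    (Km KM : ℝ) (hKm : 0 < Km)
    (hKb : ∀ᵐ x ∂(volume.restrict (Ioo (0 : ℝ) 1)), Km ≤ K x ∧ K x ≤ KM)
    (hV : Nondegenerate K β θ) :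
    -- the form is well defined: `D I^β_θ u` and `D v` are in `L²(0,1)`
    (∀ u : H0 (1 - β), MemH1 (twoSidedInt β θ u.fn)) ∧ (∀ v : H0 1, MemH1 v.fn) ∧
    -- it is bilinear and bounded
    IsBoundedBilinearMap ℝ (fun p : H0 (1 - β) × H0 1 => pgForm K β θ p.1 p.2) ∧
    ∃ κ : ℝ, 0 < κ ∧
      -- weak coercivity
      (κ : EReal) ≤ (⨅ w : {w : H0 (1 - β) // w ≠ 0}, ⨆ v : {v : H0 1 // v ≠ 0},
        ((pgForm K β θ w.1 v.1 / (‖w.1‖ * ‖v.1‖) : ℝ) : EReal)) ∧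
      (∀ v : H0 1, v ≠ 0 → (0 : EReal) < ⨆ w : H0 (1 - β), ((pgForm K β θ w v : ℝ) : EReal)) ∧
      -- well-posedness, for `f` in the dual of `H^1_0(0,1)` with the dual norm
      (∀ f : StrongDual ℝ (H0 1),
        (∃! u : H0 (1 - β), ∀ v : H0 1, pgForm K β θ u v = f v) ∧
        ∀ u : H0 (1 - β), (∀ v : H0 1, pgForm K β θ u v = f v) → ‖u‖ ≤ κ⁻¹ * ‖f‖) := by
  obtain ⟨S, hS⟩ := exists_equiv_eq_pgForm hβ0 hβ1 ⟨hθ0, hθ1⟩ hK hKm hKb hV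
  simp only [← hS]
  exact ⟨memH1_twoSidedInt hβ0 hβ1, memH1_fn,
    (S : H0 (1 - β) →L[ℝ] StrongDual ℝ (H0 1)).isBoundedBilinearMap, exists_infSup_and_wellPosed S⟩
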